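/- Let $d\ge 0$ be an integer and let $f:\mathbb R^d\to\mathbb R$ be differentiable, $m_2$-strongly convex with $m_2>0$, and with $M_2$-Lipschitz gradient. Let $x^{(0)}\in\mathbb R^d$, $\epsilon>0$ and $0<h\le \frac{m_2^{1/4}}{2M_2^{3/4}}$. Put $\theta=\frac{m_2h^2}{8}$ and $$N=\left\lceil \frac1\theta\,\log\left(\frac{4}{\epsilon^2}\left(\frac{\|\nabla f(x^{(0)})\|_2^2}{m_2}+d\right)\right)\right\rceil ,$$ with $N=0$ if the expression is negative or if $d=0$. Noisy HMC started at $x^{(0)}$ runs for $N$ steps. In step $k=1,\dots,N$ it draws $v_k\sim\mathcal N(0,I_d)$, with $v_1,\dots,v_N$ independent; it considers the solution $x(t)$, $0\le t\le h$, of $$x''(t)=-\nabla f(x(t)),\qquad x'(0)=v_k,\qquad x(0)=x^{(k-1)};$$ and it takes as $x^{(k)}$ any (random) point such that, almost surely, $$\|x^{(k)}-x(h)\|_2\le \frac{\theta\,\epsilon}{2\sqrt{m_2}} .$$ It returns $X=x^{(N)}$. Let $Y$ be distributed with density proportional to $e^{-f}$. Then, whatever the choice of the points $x^{(k)}$ subject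 to these error bounds, $$W_2(X,Y)\le \frac{\epsilon}{\sqrt{m_2}},$$ where $W_2(X,Y)=\big(\inf \mathbb E\|X'-Y'\|_2^2\big)^{1/2}$, the infimum being over all couplings $(X',Y')$ of the laws of $X$ and $Y$. Moreover, there is an absolute constant $C>0$ (independent of $d,f,m_2,M_2,x^{(0)},\epsilon,h$) such that the number of iterations satisfies $$N\le \frac{C}{m_2h^2}\,\log\left(\max\left\{2,\ \frac{\|\nabla f(x^{(0)})\|_2^2/m_2+d}{\epsilon}\right\}\right).$$ -/

import Mathlib

open MeasureTheory ProbabilityTheory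
open scoped ENNReal NNReal Gradient

/-- `γ` is a coupling of `μ` and `ν`: a measure on the product with marginals `μ` and `ν`. -/
def IsCoupling {E : Type*} [MeasurableSpace E] (μ ν : Measure E) (γ : Measure (E × E)) : Prop :=
  γ.fst = μ ∧ γ.snd = ν

/-- The `k`-th Wasserstein distance `(inf over couplings of E ‖X - Y‖ ^ k) ^ (1 / k)`,
with values in `[0, ∞]`. -/
noncomputable def wassersteinDist {E : Type*} [NormedAddCommGroup E] [MeasurableSpace E]
    (k : ℕ) (μ ν : Measure E) : ℝ≥0∞ :=
  (⨅ (γ : Measure (E × E)) (_ : IsCoupling μ ν γ), ∫⁻ z, ‖z.1 - z.2‖ₑ ^ k ∂γ) ^ (1 / (k : ℝ))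

/-- The probability measure with density proportional to `e^{-f}` with respect to Lebesgue
measure. -/
noncomputable def gibbsMeasure {d : ℕ} (f : EuclideanSpace ℝ (Fin d) → ℝ) :
    Measure (EuclideanSpace ℝ (Fin d)) :=
  (volume : Measure (EuclideanSpace ℝ (Fin d))).tilted (fun x => -f x)

/-- `q` solves the HMC dynamics on `[0, T]`: `q'' = -∇f(q)`, `q(0) = x`, `q'(0) = v`
(the function `p` below is the velocity `q'`). -/
def IsHMCTrajectory {d : ℕ} (f : EuclideanSpace ℝ (Fin d) → ℝ)
    (x v : EuclideanSpace ℝ (Fin d)) (T : ℝ) (q : ℝ → EuclideanSpace ℝ (Fin d)) : Prop :=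
  ∃ p : ℝ → EuclideanSpace ℝ (Fin d),
    q 0 = x ∧ p 0 = v ∧
    (∀ t ∈ Set.Icc 0 T, HasDerivWithinAt q (p t) (Set.Icc 0 T) t) ∧
    (∀ t ∈ Set.Icc 0 T, HasDerivWithinAt p (-∇ f (q t)) (Set.Icc 0 T) t)

/-- The parameter `θ = m₂ h² / 8`. -/
noncomputable def hmcTheta (m₂ h : ℝ) : ℝ := m₂ * h ^ 2 / 8

/-- The number of iterations
`N = (1 / θ) log ((4 / ε²) (‖∇f(x₀)‖² / m₂ + d))`, rounded up to a natural number
(and `0` if this quantity is negative). -/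
noncomputable def hmcIterations {d : ℕ} (f : EuclideanSpace ℝ (Fin d) → ℝ) (m₂ : ℝ)
    (x₀ : EuclideanSpace ℝ (Fin d)) (ε h : ℝ) : ℕ :=
  ⌈1 / hmcTheta m₂ h * Real.log (4 / ε ^ 2 * (‖∇ f x₀‖ ^ 2 / m₂ + d))⌉₊

/-- A run of the noisy HMC algorithm with `N = hmcIterations f m₂ x₀ ε h` steps on a
probability space `(Ω, P)`. In step `k + 1` a standard Gaussian velocity `v k` is drawn, the
velocities of different steps being independent, and the next iterate is any random point
within `θ ε / (2 √m₂)` of the time-`h` position of the HMC trajectory which starts at the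
current iterate with that velocity. -/
structure IsNoisyHMC {d : ℕ} {Ω : Type*} [MeasurableSpace Ω] (P : Measure Ω)
    (f : EuclideanSpace ℝ (Fin d) → ℝ) (m₂ : ℝ)
    (x₀ : EuclideanSpace ℝ (Fin d)) (ε h : ℝ)
    (v : Fin (hmcIterations f m₂ x₀ ε h) → Ω → EuclideanSpace ℝ (Fin d))
    (x : Fin (hmcIterations f m₂ x₀ ε h + 1) → Ω → EuclideanSpace ℝ (Fin d)) : Prop where
  law_velocity : ∀ k, HasLaw (v k) (stdGaussian (EuclideanSpace ℝ (Fin d))) P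
  indep_velocity : iIndepFun v P
  aemeasurable : ∀ k, AEMeasurable (x k) P
  start : ∀ᵐ ω ∂P, x 0 ω = x₀
  step : ∀ k, ∀ᵐ ω ∂P, ∃ q : ℝ → EuclideanSpace ℝ (Fin d),
    IsHMCTrajectory f (x k.castSucc ω) (v k ω) h q ∧
    ‖x k.succ ω - q h‖ ≤ hmcTheta m₂ h * ε / (2 * √m₂)

/-! The exact HMC step, as a random map of the position, has two properties. It leaves the Gibbs
measure invariant, and for each fixed velocity it contracts distances by the factor `1 - θ`. The
algorithm is compared with a stationary exact chain driven by the same velocities (synchronous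
coupling).

Invariance: the Hamiltonian flow conserves energy and Lebesgue measure on phase space, hence
preserves the Gibbs measure times the standard Gaussian. Volume preservation is obtained without
differentiating the flow: the symplectic Euler scheme is a composition of shears, which preserve
volume, and it converges to the flow; Fatou's lemma passes to the limit
(`IsHamiltonianFlow.measurePreserving`).

Contraction (`norm_sub_le_of_hamiltonian`): strong monotonicity of the gradient pulls the two
trajectories together, while cocoercivity bounds the velocity difference they build up. This needs
only `M₂ h² ≤ 1/4`, which follows from the step size condition and `m₂ ≤ M₂`.

The stationary chain starts at `Y₀`, drawn from the Gibbs measure independently of the whole run.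
With `c = 1 - θ` and `b = ε / (2√m₂)`, an error of at most `(1 - c) b` per step leads to the final
distance `c^N ‖x₀ - Y₀‖ + (1 - c^N) b`. This is a pathwise bound, so the errors may depend on
anything in the run. Integration by parts bounds `E ‖Y₀ - x₀‖²` by `2A/m₂`, where `A = ‖∇f(x₀)‖²/m₂
+ d`, and `N` is such that `4A c^N ≤ ε²`. The squared distance is then at most `ε²/(2m₂) +
ε²/(4m₂)`. -/

/-! ### Convexity, smoothness and cocoercivity inequalities -/

section GradientInequalities

variable {E : Type*} [NormedAddCommGroup E] [InnerProductSpace ℝ E]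

theorem hasDerivAt_comp_add_smul [CompleteSpace E] {f : E → ℝ}
    (hf : Differentiable ℝ f) (x u : E) (t : ℝ) :
    HasDerivAt (fun s : ℝ => f (x + s • u)) (inner ℝ (∇ f (x + t • u)) u) t := by
  have h1 := (hf (x + t • u)).hasGradientAt.hasFDerivAt
  have h2 : HasDerivAt (fun s : ℝ => x + s • u) u t := by
    simpa using ((hasDerivAt_id t).smul_const u).const_add x
  have h3 := h1.comp_hasDerivAt t h2
  rwa [InnerProductSpace.toDual_apply_apply] at h3

/-- Strong convexity on the segment from `x` to `y`, divided by `t`, bounds the difference quotient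
of `f` at `x`; then `t → 0+`. -/
theorem StrongConvexOn.add_inner_gradient_le [CompleteSpace E] {f : E → ℝ} {m : ℝ}
    (hc : StrongConvexOn Set.univ m f) (hf : Differentiable ℝ f) (x y : E) :
    f x + inner ℝ (∇ f x) (y - x) + m / 2 * ‖y - x‖ ^ 2 ≤ f y := by
  have hd := hasDerivAt_comp_add_smul hf x (y - x) 0
  have h1 := hd.tendsto_slope_zero_right
  simp only [zero_smul, add_zero, zero_add, smul_eq_mul] at h1
  have h2 : Filter.Tendsto (fun t : ℝ => f y - f x - (1 - t) * (m / 2 * ‖y - x‖ ^ 2))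
      (nhdsWithin 0 (Set.Ioi 0)) (nhds (f y - f x - (1 - 0) * (m / 2 * ‖y - x‖ ^ 2))) := by
    refine Filter.Tendsto.mono_left (Continuous.tendsto ?_ 0) nhdsWithin_le_nhds
    fun_prop
  have h3 := le_of_tendsto_of_tendsto h1 h2 (by
    filter_upwards [Ioo_mem_nhdsGT (show (0 : ℝ) < 1 by norm_num)] with t ht
    have h := (hc.2 (Set.mem_univ x) (Set.mem_univ y)) (sub_nonneg.2 ht.2.le) ht.1.le
      (by ring)
    have he : (1 - t) • x + t • y = x + t • (y - x) := by
      rw [sub_smul, smul_sub, one_smul]; abel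
    rw [he, norm_sub_rev] at h
    simp only [smul_eq_mul] at h
    rw [inv_mul_le_iff₀ ht.1]
    linarith)
  linarith

theorem StrongConvexOn.inner_gradient_sub_ge [CompleteSpace E] {f : E → ℝ} {m : ℝ}
    (hc : StrongConvexOn Set.univ m f) (hf : Differentiable ℝ f) (x y : E) :
    m * ‖x - y‖ ^ 2 ≤ inner ℝ (∇ f x - ∇ f y) (x - y) := by
  have h1 := hc.add_inner_gradient_le hf x y
  have h2 := hc.add_inner_gradient_le hf y x
  rw [norm_sub_rev] at h1
  have h3 : inner ℝ (∇ f x) (y - x) = - inner ℝ (∇ f x) (x - y) := by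
    rw [← neg_sub x y, inner_neg_right]
  rw [inner_sub_left]
  linarith

/-- A function on `[0, T]` with nonpositive derivative stays below its initial value. -/
theorem le_initial_of_hasDerivWithinAt_nonpos {ψ ψ' : ℝ → ℝ} {T : ℝ}
    (hψ : ∀ t ∈ Set.Icc 0 T, HasDerivWithinAt ψ (ψ' t) (Set.Icc 0 T) t)
    (h : ∀ t ∈ Set.Icc 0 T, ψ' t ≤ 0) {t : ℝ} (ht : t ∈ Set.Icc 0 T) : ψ t ≤ ψ 0 := by
  have := antitoneOn_of_hasDerivWithinAt_nonpos (convex_Icc 0 T) (f := ψ) (f' := ψ')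
    (fun t ht => (hψ t ht).continuousWithinAt)
    (fun t ht => (hψ t (interior_subset ht)).mono interior_subset)
    (fun t ht => h t (interior_subset ht))
  exact this ⟨le_rfl, ht.1.trans ht.2⟩ ht ht.1

/-- The descent lemma. -/
theorem le_add_inner_gradient_of_lipschitz [CompleteSpace E] {f : E → ℝ} {M : ℝ≥0}
    (hf : Differentiable ℝ f) (hL : LipschitzWith M (∇ f)) (x y : E) :
    f y ≤ f x + inner ℝ (∇ f x) (y - x) + M / 2 * ‖y - x‖ ^ 2 := by
  set u := y - x
  have h := le_initial_of_hasDerivWithinAt_nonpos (T := 1)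
    (ψ := fun t => f (x + t • u) - (t * inner ℝ (∇ f x) u + t ^ 2 * (M / 2 * ‖u‖ ^ 2)))
    (ψ' := fun t => inner ℝ (∇ f (x + t • u)) u -
      (inner ℝ (∇ f x) u + 2 * t * (M / 2 * ‖u‖ ^ 2)))
    (fun t _ => by
      refine HasDerivAt.hasDerivWithinAt ?_
      refine (hasDerivAt_comp_add_smul hf x u t).sub (HasDerivAt.add ?_ ?_)
      · simpa using (hasDerivAt_id t).mul_const (inner ℝ (∇ f x) u)
      · simpa using (hasDerivAt_pow 2 t).mul_const (M / 2 * ‖u‖ ^ 2))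
    (fun t ht => by
      have h1 : inner ℝ (∇ f (x + t • u) - ∇ f x) u ≤ M * t * ‖u‖ ^ 2 := by
        refine (real_inner_le_norm _ _).trans ?_
        have := hL.norm_sub_le (x + t • u) x
        rw [add_sub_cancel_left, norm_smul, Real.norm_of_nonneg ht.1] at this
        calc _ ≤ (M * (t * ‖u‖)) * ‖u‖ := by gcongr
          _ = _ := by ring
      rw [inner_sub_left] at h1
      linarith) (t := 1) ⟨zero_le_one, le_rfl⟩
  simp only [one_smul, zero_smul, add_zero] at h
  have : x + u = y := by simp [u]
  rw [this] at h
  linarith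

/-- The value at `y - D / M` is bounded above by the descent lemma from `y` and below by convexity
from `x`. The linear terms in `D` combine to `‖D‖² / M`, half of which survives the quadratic term.
-/
theorem add_inner_gradient_add_norm_sq_le [CompleteSpace E] {f : E → ℝ} {M : ℝ≥0}
    (hc : ∀ x y, f x + inner ℝ (∇ f x) (y - x) ≤ f y) (hM : 0 < M)
    (hf : Differentiable ℝ f) (hL : LipschitzWith M (∇ f)) (x y : E) :
    f x + inner ℝ (∇ f x) (y - x) + 1 / (2 * M) * ‖∇ f y - ∇ f x‖ ^ 2 ≤ f y := by
  set D := ∇ f y - ∇ f x with hD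
  have hM' : (0 : ℝ) < M := hM
  have h1 := le_add_inner_gradient_of_lipschitz hf hL y (y - (1 / (M : ℝ)) • D)
  have h2 := hc x (y - (1 / (M : ℝ)) • D)
  have e1 : y - (1 / (M : ℝ)) • D - y = -((1 / (M : ℝ)) • D) := by abel
  have e2 : y - (1 / (M : ℝ)) • D - x = (y - x) - (1 / (M : ℝ)) • D := by abel
  rw [e1, inner_neg_right, norm_neg, norm_smul, inner_smul_right, Real.norm_of_nonneg (by positivity)]
    at h1
  rw [e2, inner_sub_right, inner_smul_right] at h2
  have h3 : inner ℝ (∇ f y) D - inner ℝ (∇ f x) D = ‖D‖ ^ 2 := by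
    rw [← inner_sub_left, ← hD, real_inner_self_eq_norm_sq]
  have h4 : (M : ℝ) / 2 * (1 / M * ‖D‖) ^ 2 = 1 / (2 * M) * ‖D‖ ^ 2 := by field_simp
  have h5 : 1 / (M : ℝ) * (inner ℝ (∇ f y) D - inner ℝ (∇ f x) D) = 2 * (1 / (2 * M) * ‖D‖ ^ 2) := by
    rw [h3]; field_simp
  rw [h4] at h1
  linarith

/-- Cocoercivity of the gradient (Baillon–Haddad). -/
theorem norm_gradient_sub_sq_le [CompleteSpace E] {f : E → ℝ} {M : ℝ≥0}
    (hc : ∀ x y, f x + inner ℝ (∇ f x) (y - x) ≤ f y) (hM : 0 < M)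
    (hf : Differentiable ℝ f) (hL : LipschitzWith M (∇ f)) (x y : E) :
    ‖∇ f x - ∇ f y‖ ^ 2 ≤ M * inner ℝ (∇ f x - ∇ f y) (x - y) := by
  have hM' : (0 : ℝ) < M := hM
  have h1 := add_inner_gradient_add_norm_sq_le hc hM hf hL x y
  have h2 := add_inner_gradient_add_norm_sq_le hc hM hf hL y x
  rw [norm_sub_rev] at h1
  have h3 : inner ℝ (∇ f x) (y - x) = - inner ℝ (∇ f x) (x - y) := by
    rw [← neg_sub x y, inner_neg_right]
  rw [inner_sub_left]
  have h4 : 1 / (2 * (M : ℝ)) * ‖∇ f x - ∇ f y‖ ^ 2 * (2 * M) = ‖∇ f x - ∇ f y‖ ^ 2 := by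
    field_simp
  nlinarith

end GradientInequalities

/-! ### Contraction of trajectories with equal initial velocity -/

section Contraction

variable {E : Type*} [NormedAddCommGroup E] [InnerProductSpace ℝ E]

theorem ContinuousOn.exists_primitive_Icc {φ : ℝ → ℝ} {T : ℝ} (hT : 0 ≤ T)
    (hφ : ContinuousOn φ (Set.Icc 0 T)) :
    ∃ F : ℝ → ℝ, F 0 = 0 ∧
      ∀ t ∈ Set.Icc 0 T, HasDerivWithinAt F (φ t) (Set.Icc 0 T) t := by
  have hc : Continuous (Set.IccExtend hT (Set.domRestrict (Set.Icc 0 T) φ)) :=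
    (continuousOn_iff_continuous_domRestrict.1 hφ).Icc_extend'
  refine ⟨fun t => ∫ s in (0 : ℝ)..t, Set.IccExtend hT (Set.domRestrict (Set.Icc 0 T) φ) s,
    by simp, fun t ht => ?_⟩
  have := (hc.integral_hasStrictDerivAt 0 t).hasDerivAt.hasDerivWithinAt (s := Set.Icc 0 T)
  rwa [Set.IccExtend_of_mem hT _ ht] at this

/-- Two trajectories of `q'' = -g(q)` with equal initial velocity, `g` strongly monotone and
cocoercive, contract over short times. -/
theorem norm_sub_le_of_hamiltonian {g : E → E} {m M T : ℝ} (hm : 0 ≤ m) (hM : 0 ≤ M)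
    (hmM : m ≤ M) (hT : 0 < T) (hMT : M * T ^ 2 ≤ 1 / 4)
    (hmono : ∀ x y, m * ‖x - y‖ ^ 2 ≤ inner ℝ (g x - g y) (x - y))
    (hcoco : ∀ x y, ‖g x - g y‖ ^ 2 ≤ M * inner ℝ (g x - g y) (x - y))
    (hg : Continuous g) (hLip : ∀ x y, ‖g x - g y‖ ≤ M * ‖x - y‖)
    {q₁ p₁ q₂ p₂ : ℝ → E}
    (hq₁ : ∀ t ∈ Set.Icc 0 T, HasDerivWithinAt q₁ (p₁ t) (Set.Icc 0 T) t)
    (hp₁ : ∀ t ∈ Set.Icc 0 T, HasDerivWithinAt p₁ (-g (q₁ t)) (Set.Icc 0 T) t)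
    (hq₂ : ∀ t ∈ Set.Icc 0 T, HasDerivWithinAt q₂ (p₂ t) (Set.Icc 0 T) t)
    (hp₂ : ∀ t ∈ Set.Icc 0 T, HasDerivWithinAt p₂ (-g (q₂ t)) (Set.Icc 0 T) t)
    (h0 : p₁ 0 = p₂ 0) :
    ‖q₁ T - q₂ T‖ ≤ (1 - m * T ^ 2 / 8) * ‖q₁ 0 - q₂ 0‖ := by
  set u : ℝ → E := fun t => q₁ t - q₂ t with hu_def
  set w : ℝ → E := fun t => p₁ t - p₂ t with hw_def
  set D : ℝ → E := fun t => g (q₁ t) - g (q₂ t) with hD_def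
  set φ : ℝ → ℝ := fun t => inner ℝ (D t) (u t) with hφ_def
  have hu : ∀ t ∈ Set.Icc 0 T, HasDerivWithinAt u (w t) (Set.Icc 0 T) t :=
    fun t ht => (hq₁ t ht).sub (hq₂ t ht)
  have hw : ∀ t ∈ Set.Icc 0 T, HasDerivWithinAt w (-D t) (Set.Icc 0 T) t := fun t ht => by
    have := (hp₁ t ht).sub (hp₂ t ht)
    rwa [show -g (q₁ t) - -g (q₂ t) = -D t by simp only [hD_def]; abel] at this
  have hw0 : w 0 = 0 := by simp [hw_def, h0]
  have hφ0 : ∀ t, 0 ≤ φ t := fun t => le_trans (by positivity) (hmono (q₁ t) (q₂ t))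
  have hφc : ContinuousOn φ (Set.Icc 0 T) := by
    have c1 : ContinuousOn q₁ (Set.Icc 0 T) := fun t ht => (hq₁ t ht).continuousWithinAt
    have c2 : ContinuousOn q₂ (Set.Icc 0 T) := fun t ht => (hq₂ t ht).continuousWithinAt
    exact ((hg.comp_continuousOn c1).sub (hg.comp_continuousOn c2)).inner (c1.sub c2)
  -- `F` and `G` are the first and second iterated integrals of `φ`; every estimate below is a
  -- differential inequality in these.
  obtain ⟨F, hF0, hF⟩ := hφc.exists_primitive_Icc hT.le
  obtain ⟨G, hG0, hG⟩ := ContinuousOn.exists_primitive_Icc (φ := F) hT.le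
    (fun t ht => (hF t ht).continuousWithinAt)
  have hFnn : ∀ t ∈ Set.Icc 0 T, 0 ≤ F t := fun t ht => by
    have := le_initial_of_hasDerivWithinAt_nonpos (ψ := fun t => -F t)
      (fun t ht => (hF t ht).neg) (fun t _ => neg_nonpos.2 (hφ0 t)) ht
    simp only [hF0] at this; linarith
  have hGnn : ∀ t ∈ Set.Icc 0 T, 0 ≤ G t := fun t ht => by
    have := le_initial_of_hasDerivWithinAt_nonpos (ψ := fun t => -G t)
      (fun t ht => (hG t ht).neg) (fun t ht => neg_nonpos.2 (hFnn t ht)) ht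
    simp only [hG0] at this; linarith
  -- `w t` is minus the integral of `D`, so Cauchy–Schwarz and cocoercivity give the bound. It is
  -- derived by pairing `w s` with the fixed vector `w t` and applying Young's inequality.
  have hW : ∀ t ∈ Set.Icc 0 T, ‖w t‖ ^ 2 ≤ M * T * F t := fun t ht => by
    have := le_initial_of_hasDerivWithinAt_nonpos
      (ψ := fun s => inner ℝ (w s) (w t) - s * (‖w t‖ ^ 2 / (2 * T)) - T * M / 2 * F s)
      (ψ' := fun s => inner ℝ (-D s) (w t) - ‖w t‖ ^ 2 / (2 * T) - T * M / 2 * φ s)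
      (fun s hs => by
        refine (HasDerivWithinAt.sub ?_ ?_).sub ((hF s hs).const_mul _)
        · simpa using (hw s hs).inner ℝ (hasDerivWithinAt_const s (Set.Icc 0 T) (w t))
        · simpa using (hasDerivWithinAt_id s (Set.Icc 0 T)).mul_const (‖w t‖ ^ 2 / (2 * T)))
      (fun s hs => by
        have h1 : inner ℝ (-D s) (w t) ≤ ‖D s‖ * ‖w t‖ := by
          simpa using real_inner_le_norm (-D s) (w t)
        have h2 : T / 2 * ‖D s‖ ^ 2 ≤ T / 2 * (M * φ s) :=
          mul_le_mul_of_nonneg_left (hcoco _ _) (by positivity)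
        have h3 : 0 ≤ (T * ‖D s‖ - ‖w t‖) ^ 2 / (2 * T) := by positivity
        have h4 : (T * ‖D s‖ - ‖w t‖) ^ 2 / (2 * T) =
            T / 2 * ‖D s‖ ^ 2 - ‖D s‖ * ‖w t‖ + ‖w t‖ ^ 2 / (2 * T) := by
          field_simp; ring
        linarith) ht
    simp only [hw0, inner_zero_left, hF0, real_inner_self_eq_norm_sq] at this
    have h5 : t * (‖w t‖ ^ 2 / (2 * T)) ≤ T * (‖w t‖ ^ 2 / (2 * T)) := by
      gcongr; exact ht.2
    have h6 : T * (‖w t‖ ^ 2 / (2 * T)) = ‖w t‖ ^ 2 / 2 := by field_simp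
    linarith
  -- The derivative of `⟪u, w⟫` is `‖w‖² - φ`, with `‖w‖²` controlled by `hW`.
  have hB : ∀ t ∈ Set.Icc 0 T, inner ℝ (u t) (w t) ≤ - F t + M * T * G t := fun t ht => by
    have := le_initial_of_hasDerivWithinAt_nonpos
      (ψ := fun s => inner ℝ (u s) (w s) + F s - M * T * G s)
      (fun s hs => (((hu s hs).inner ℝ (hw s hs)).add (hF s hs)).sub ((hG s hs).const_mul _))
      (fun s hs => by
        have h1 := hW s hs
        have h2 : inner ℝ (u s) (D s) = φ s := real_inner_comm _ _
        rw [inner_neg_right, h2, real_inner_self_eq_norm_sq]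
        linarith) ht
    simp only [hw0, hF0, hG0, inner_zero_right] at this
    linarith
  have hA : ∀ t ∈ Set.Icc 0 T, ‖u t‖ ^ 2 ≤ ‖u 0‖ ^ 2 - 3 / 2 * G t := fun t ht => by
    have := le_initial_of_hasDerivWithinAt_nonpos
      (ψ := fun s => ‖u s‖ ^ 2 + 2 * G s - 2 * (M * T) * (s * G s))
      (fun s hs => ((hu s hs).norm_sq.add ((hG s hs).const_mul _)).sub
        (((hasDerivWithinAt_id s (Set.Icc 0 T)).mul (hG s hs)).const_mul _))
      (fun s hs => by
        have h1 := hB s hs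
        have h2 : 0 ≤ M * T * (s * F s) := by
          have := hFnn s hs; have := hs.1; positivity
        simp only [id]
        linarith) ht
    simp only [hG0] at this
    have h3 : M * T * t ≤ 1 / 4 := by
      refine le_trans ?_ hMT
      rw [pow_two, ← mul_assoc]
      have := ht.2; gcongr
    have h4 : M * T * t * G t ≤ 1 / 4 * G t := mul_le_mul_of_nonneg_right h3 (hGnn t ht)
    linarith
  have hup : ∀ t ∈ Set.Icc 0 T, ‖u t‖ ≤ ‖u 0‖ := fun t ht =>
    le_of_sq_le_sq (by linarith [hA t ht, hGnn t ht]) (norm_nonneg _)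
  have hwu : ∀ t ∈ Set.Icc 0 T, ‖w t‖ ≤ M * ‖u 0‖ * T := fun t ht => by
    have := (convex_Icc 0 T).norm_image_sub_le_of_norm_hasDerivWithin_le hw
      (C := M * ‖u 0‖) (fun s hs => by
        rw [norm_neg]
        refine (hLip _ _).trans ?_
        gcongr; exact hup s hs) ⟨le_rfl, hT.le⟩ ht
    rw [hw0, sub_zero, sub_zero, Real.norm_of_nonneg ht.1] at this
    refine this.trans ?_
    have := ht.2; gcongr
  -- Over time `T` the difference `u` moves by at most `M T² ‖u 0‖ ≤ ‖u 0‖ / 4`, so `φ` stays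
  -- bounded below.
  have hlow : ∀ t ∈ Set.Icc 0 T, 3 / 4 * ‖u 0‖ ≤ ‖u t‖ := fun t ht => by
    have := (convex_Icc 0 T).norm_image_sub_le_of_norm_hasDerivWithin_le hu
      hwu ⟨le_rfl, hT.le⟩ ht
    rw [sub_zero, Real.norm_of_nonneg ht.1] at this
    have h1 : M * ‖u 0‖ * T * t ≤ 1 / 4 * ‖u 0‖ := by
      calc M * ‖u 0‖ * T * t ≤ M * ‖u 0‖ * T * T := by have := ht.2; gcongr
        _ = M * T ^ 2 * ‖u 0‖ := by ring
        _ ≤ _ := by gcongr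
    have h2 := norm_sub_norm_le (u 0) (u t)
    rw [norm_sub_rev (u 0) (u t)] at h2
    linarith
  set c := m * (9 / 16 * ‖u 0‖ ^ 2) with hc
  have hφl : ∀ t ∈ Set.Icc 0 T, c ≤ φ t := fun t ht => by
    refine le_trans ?_ (hmono _ _)
    refine mul_le_mul_of_nonneg_left ?_ hm
    have := pow_le_pow_left₀ (by positivity) (hlow t ht) 2
    calc _ = (3 / 4 * ‖u 0‖) ^ 2 := by ring
      _ ≤ _ := this
  have hFl : ∀ t ∈ Set.Icc 0 T, c * t ≤ F t := fun t ht => by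
    have := le_initial_of_hasDerivWithinAt_nonpos (ψ := fun t => c * t - F t)
      (fun t ht => ((hasDerivWithinAt_id t (Set.Icc 0 T)).const_mul c).sub (hF t ht))
      (fun t ht => by linarith [hφl t ht]) ht
    simp only [hF0] at this; linarith
  have hGl : c * T ^ 2 / 2 ≤ G T := by
    have := le_initial_of_hasDerivWithinAt_nonpos (ψ := fun t => c / 2 * t ^ 2 - G t)
      (fun t ht => ((hasDerivAt_pow 2 t).hasDerivWithinAt (s := Set.Icc 0 T)
        |>.const_mul (c / 2)).sub (hG t ht))
      (fun t ht => by
        have := hFl t ht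
        norm_num; linarith) (t := T) ⟨hT.le, le_rfl⟩
    simp only [hG0] at this; linarith
  have hfin := hA T ⟨hT.le, le_rfl⟩
  have hmT : m * T ^ 2 ≤ 1 / 4 := (mul_le_mul_of_nonneg_right hmM (by positivity)).trans hMT
  -- The bounds give `‖u T‖² ≤ (1 - 27/64 · m T²) ‖u 0‖²`, and `(1 - m T² / 8)² ≥ 1 - m T² / 4`.
  refine le_of_sq_le_sq ?_ (mul_nonneg (by linarith) (norm_nonneg _))
  have h7 : 0 ≤ m * T ^ 2 * ‖u 0‖ ^ 2 := by positivity
  have h8 : 0 ≤ (m * T ^ 2) ^ 2 * ‖u 0‖ ^ 2 := by positivity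
  change ‖u T‖ ^ 2 ≤ ((1 - m * T ^ 2 / 8) * ‖u 0‖) ^ 2
  rw [hc] at hGl
  nlinarith

end Contraction

/-! ### The Hamiltonian flow and its symplectic Euler approximation -/

section HamiltonianFlow

/-- Solutions of an autonomous ODE with Lipschitz vector field exist for short times. -/
theorem LipschitzWith.exists_hasDerivWithinAt_Icc {F : Type*} [NormedAddCommGroup F]
    [NormedSpace ℝ F] [CompleteSpace F] {V : F → F} {K : ℝ≥0} (hV : LipschitzWith K V) {T : ℝ}
    (hT : 0 ≤ T) (hKT : K * T ≤ 1 / 2) (z : F) :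
    ∃ α : ℝ → F, α 0 = z ∧
      ∀ t ∈ Set.Icc 0 T, HasDerivWithinAt α (V (α t)) (Set.Icc 0 T) t := by
  lift T to ℝ≥0 using hT
  -- On the ball of radius `2 T ‖V z‖` the field is at most `‖V z‖ + K · 2 T ‖V z‖ ≤ 2 ‖V z‖`, so
  -- the solution cannot leave it before time `T`.
  have hpl : IsPicardLindelof (fun _ => V) (tmin := 0) (tmax := (T : ℝ))
      ⟨0, le_rfl, T.2⟩ z (2 * T * ‖V z‖₊) 0 (‖V z‖₊ + K * (2 * T * ‖V z‖₊)) K := by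
    refine IsPicardLindelof.of_time_independent (fun x hx => ?_) hV.lipschitzOnWith ?_
    · have h1 := hV.norm_sub_le x z
      rw [mem_closedBall_iff_norm] at hx
      have h2 := norm_le_insert' (V x) (V z)
      push_cast at hx ⊢
      have h3 : (K : ℝ) * ‖x - z‖ ≤ K * (2 * T * ‖V z‖) := by gcongr
      linarith
    · have h4 : (K * T : ℝ) * (2 * T * ‖V z‖) ≤ 1 / 2 * (2 * T * ‖V z‖) := by gcongr
      have h5 : max ((T : ℝ) - 0) (0 - 0) = T := by simp
      change ((‖V z‖₊ + K * (2 * T * ‖V z‖₊) : ℝ≥0) : ℝ) * max ((T : ℝ) - 0) (0 - 0) ≤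
        ((2 * T * ‖V z‖₊ : ℝ≥0) : ℝ) - ((0 : ℝ≥0) : ℝ)
      rw [h5]
      push_cast
      linarith
  exact hpl.exists_eq_forall_mem_Icc_hasDerivWithinAt₀

variable {E : Type*} [NormedAddCommGroup E] [InnerProductSpace ℝ E]

/-- `q` and `p` solve `q' = p`, `p' = -g(q)` on `[0, T]`. -/
structure IsHamiltonianSolution (g : E → E) (T : ℝ) (q p : ℝ → E) : Prop where
  position : ∀ t ∈ Set.Icc 0 T, HasDerivWithinAt q (p t) (Set.Icc 0 T) t
  velocity : ∀ t ∈ Set.Icc 0 T, HasDerivWithinAt p (-g (q t)) (Set.Icc 0 T) t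

/-- `Φ` is the time-`T` map of `q' = p`, `p' = -g(q)`. -/
def IsHamiltonianFlow (g : E → E) (T : ℝ) (Φ : E × E → E × E) : Prop :=
  ∀ z, ∃ q p : ℝ → E, IsHamiltonianSolution g T q p ∧ (q 0, p 0) = z ∧ (q T, p T) = Φ z

/-- One step of the symplectic Euler scheme. -/
def symplecticEuler (g : E → E) (s : ℝ) (z : E × E) : E × E :=
  (z.1 + s • z.2, z.2 - s • g (z.1 + s • z.2))

variable {g : E → E} {M : ℝ≥0} {T : ℝ}

/-- Dividing the velocity by `√M` makes the vector field `√M`-Lipschitz, and `√M T ≤ 1/2` is exactly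
the hypothesis. One Picard–Lindelöf step therefore covers `[0, T]`. -/
theorem exists_isHamiltonianFlow [CompleteSpace E] (hg : LipschitzWith M g) (hM : 0 < M)
    (hT : 0 ≤ T) (hMT : M * T ^ 2 ≤ 1 / 4) : ∃ Φ, IsHamiltonianFlow g T Φ := by
  have key : ∀ z : E × E, ∃ w : E × E, ∃ q p : ℝ → E, IsHamiltonianSolution g T q p ∧
      (q 0, p 0) = z ∧ (q T, p T) = w := by
    intro z
    set s : ℝ≥0 := NNReal.sqrt M with hs
    have hs0 : 0 < s := by simpa [hs] using hM
    have hs0' : (0 : ℝ) < s := hs0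
    have hss : s * s = M := NNReal.mul_self_sqrt M
    have hss' : (s * s : ℝ) = M := by exact_mod_cast congrArg NNReal.toReal hss
    have hV : LipschitzWith s (fun y : E × E => ((s : ℝ) • y.2, -((s : ℝ)⁻¹ • g y.1))) := by
      refine LipschitzWith.of_dist_le_mul fun y y' => ?_
      rw [Prod.dist_eq]
      refine max_le ?_ ?_
      · rw [dist_smul₀, Real.norm_of_nonneg hs0'.le]
        gcongr
        exact le_max_right _ _
      · dsimp only
        rw [dist_neg_neg, dist_smul₀, norm_inv, Real.norm_of_nonneg hs0'.le,
          inv_mul_le_iff₀ hs0', ← mul_assoc, hss']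
        refine (hg.dist_le_mul _ _).trans ?_
        gcongr
        exact le_max_left _ _
    have hsT : (s : ℝ) * T ≤ 1 / 2 := by
      refine le_of_sq_le_sq ?_ (by norm_num)
      calc ((s : ℝ) * T) ^ 2 = s * s * T ^ 2 := by ring
        _ ≤ _ := by rw [hss']; linarith
    obtain ⟨α, hα0, hα⟩ := hV.exists_hasDerivWithinAt_Icc hT hsT (z.1, (s : ℝ)⁻¹ • z.2)
    refine ⟨_, fun t => (α t).1, fun t => (s : ℝ) • (α t).2, ⟨fun t ht => ?_, fun t ht => ?_⟩,
      ?_, rfl⟩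
    · exact (ContinuousLinearMap.fst ℝ E E).hasFDerivAt.comp_hasDerivWithinAt t (hα t ht)
    · have := ((ContinuousLinearMap.snd ℝ E E).hasFDerivAt.comp_hasDerivWithinAt t
        (hα t ht)).const_smul (s : ℝ)
      simp only [ContinuousLinearMap.coe_snd', smul_neg, smul_smul, mul_inv_cancel₀ hs0'.ne',
        one_smul] at this
      exact this
    · simp only [hα0, smul_smul, mul_inv_cancel₀ hs0'.ne', one_smul]
  choose Φ hΦ using key
  exact ⟨Φ, hΦ⟩

theorem IsHamiltonianSolution.dist_le (hg : LipschitzWith M g) (hT : 0 ≤ T)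
    {q p q' p' : ℝ → E} (h : IsHamiltonianSolution g T q p) (h' : IsHamiltonianSolution g T q' p') :
    dist (q T, p T) (q' T, p' T) ≤
      dist (q 0, p 0) (q' 0, p' 0) * Real.exp ((max 1 M : ℝ≥0) * T) := by
  have hV : LipschitzWith (max 1 M) (fun y : E × E => (y.2, -g y.1)) := by
    refine (LipschitzWith.prod_snd (α := E) (β := E)).prodMk ?_
    have h1 := (hg.comp (LipschitzWith.prod_fst (α := E) (β := E))).neg
    rw [mul_one] at h1
    exact h1
  have hd : ∀ {q p : ℝ → E}, IsHamiltonianSolution g T q p → ∀ t ∈ Set.Icc 0 T,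
      HasDerivWithinAt (fun t => (q t, p t)) (p t, -g (q t)) (Set.Icc 0 T) t :=
    fun h t ht => (h.position t ht).prodMk (h.velocity t ht)
  have hr : ∀ {q p : ℝ → E}, IsHamiltonianSolution g T q p → ∀ t ∈ Set.Ico 0 T,
      HasDerivWithinAt (fun t => (q t, p t)) (p t, -g (q t)) (Set.Ici t) t :=
    fun h t ht => (hd h t ⟨ht.1, ht.2.le⟩).mono_of_mem_nhdsWithin
      (Icc_mem_nhdsGE_of_mem ht)
  have := dist_le_of_trajectories_ODE (v := fun _ y => (y.2, -g y.1)) (K := max 1 M)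
    (f := fun t => (q t, p t)) (g := fun t => (q' t, p' t)) (a := 0) (b := T) (fun _ => hV)
    (fun t ht => (hd h t ht).continuousWithinAt) (hr h)
    (fun t ht => (hd h' t ht).continuousWithinAt) (hr h') le_rfl T ⟨hT, le_rfl⟩
  simpa only [sub_zero] using this

/-- Uniqueness, by Grönwall: whichever trajectory a run of the algorithm supplies, its endpoint is
the value of `Φ`. -/
theorem IsHamiltonianFlow.apply_eq (hg : LipschitzWith M g) (hT : 0 ≤ T) {Φ : E × E → E × E}
    (hΦ : IsHamiltonianFlow g T Φ) {q p : ℝ → E} (h : IsHamiltonianSolution g T q p) :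
    Φ (q 0, p 0) = (q T, p T) := by
  obtain ⟨q', p', h', h0, hT'⟩ := hΦ (q 0, p 0)
  have := h'.dist_le hg hT h
  rw [h0, dist_self, zero_mul, hT'] at this
  exact dist_le_zero.1 this

theorem IsHamiltonianFlow.continuous (hg : LipschitzWith M g) (hT : 0 ≤ T) {Φ : E × E → E × E}
    (hΦ : IsHamiltonianFlow g T Φ) : Continuous Φ := by
  refine (LipschitzWith.of_dist_le_mul (K := (Real.exp ((max 1 M : ℝ≥0) * T)).toNNReal)
    fun z z' => ?_).continuous
  obtain ⟨q, p, h, h0, h1⟩ := hΦ z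
  obtain ⟨q', p', h', h0', h1'⟩ := hΦ z'
  have := h.dist_le hg hT h'
  rwa [h0, h0', h1, h1', mul_comm, ← Real.coe_toNNReal _ (Real.exp_pos _).le] at this

/-- Conservation of energy. -/
theorem IsHamiltonianFlow.energy_eq [CompleteSpace E] {f : E → ℝ} (hf : Differentiable ℝ f)
    (hT : 0 ≤ T) {Φ : E × E → E × E} (hΦ : IsHamiltonianFlow (∇ f) T Φ) (z : E × E) :
    f (Φ z).1 + ‖(Φ z).2‖ ^ 2 / 2 = f z.1 + ‖z.2‖ ^ 2 / 2 := by
  obtain ⟨q, p, h, h0, h1⟩ := hΦ z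
  have hd : ∀ t ∈ Set.Icc 0 T, HasDerivWithinAt (fun t => f (q t) + ‖p t‖ ^ 2 / 2) 0
      (Set.Icc 0 T) t := fun t ht => by
    have d1 := (hf (q t)).hasGradientAt.hasFDerivAt.comp_hasDerivWithinAt t (h.position t ht)
    have d2 := (h.velocity t ht).norm_sq.div_const 2
    have d3 := d1.add d2
    rw [InnerProductSpace.toDual_apply_apply, inner_neg_right, real_inner_comm] at d3
    convert! d3 using 1
    ring
  have := (convex_Icc 0 T).norm_image_sub_le_of_norm_hasDerivWithin_le hd
    (C := 0) (fun s hs => by simp) ⟨le_rfl, hT⟩ ⟨hT, le_rfl⟩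
  rw [zero_mul, norm_le_zero_iff, sub_eq_zero] at this
  rw [← h1, ← h0]
  exact this

theorem dist_symplecticEuler_le (hg : LipschitzWith M g) {s : ℝ} (hs : 0 ≤ s) (hsT : s ≤ T)
    (z z' : E × E) : dist (symplecticEuler g s z) (symplecticEuler g s z') ≤
      Real.exp ((1 + M * (1 + T)) * s) * dist z z' := by
  have h1 : dist (z.1 + s • z.2) (z'.1 + s • z'.2) ≤ (1 + s) * dist z z' := by
    refine (dist_add_add_le _ _ _ _).trans ?_
    rw [dist_smul₀, Real.norm_of_nonneg hs, add_mul, one_mul]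
    gcongr
    · exact le_max_left _ _
    · exact le_max_right _ _
  have h2 : 1 + (1 + M * (1 + T)) * s ≤ Real.exp ((1 + M * (1 + T)) * s) := by
    linarith [Real.add_one_le_exp ((1 + M * (1 + T)) * s)]
  refine le_trans ?_ (mul_le_mul_of_nonneg_right h2 dist_nonneg)
  have hT : 0 ≤ T := hs.trans hsT
  rw [Prod.dist_eq]
  refine max_le (h1.trans ?_) ?_
  · have : 0 ≤ M * (1 + T) * s * dist z z' := by positivity
    linarith
  · refine (dist_sub_sub_le _ _ _ _).trans ?_
    rw [dist_smul₀, Real.norm_of_nonneg hs]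
    have h3 : dist (g (z.1 + s • z.2)) (g (z'.1 + s • z'.2)) ≤ M * ((1 + T) * dist z z') := by
      refine (hg.dist_le_mul _ _).trans ?_
      gcongr
      refine h1.trans ?_
      gcongr
    have h4 : dist z.2 z'.2 ≤ dist z z' := le_max_right _ _
    have h5 := mul_le_mul_of_nonneg_left h3 hs
    have h6 : 0 ≤ s * dist z z' := by positivity
    linarith

/-- The local error of the symplectic Euler scheme is quadratic. -/
theorem IsHamiltonianSolution.exists_local_error (hg : LipschitzWith M g)
    {q p : ℝ → E} (h : IsHamiltonianSolution g T q p) :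
    ∃ C : ℝ, 0 ≤ C ∧ ∀ t s : ℝ, 0 ≤ t → 0 ≤ s → t + s ≤ T →
      dist (symplecticEuler g s (q t, p t)) (q (t + s), p (t + s)) ≤ C * s ^ 2 := by
  have hq : ContinuousOn q (Set.Icc 0 T) := fun t ht => (h.position t ht).continuousWithinAt
  have hp : ContinuousOn p (Set.Icc 0 T) := fun t ht => (h.velocity t ht).continuousWithinAt
  obtain ⟨P, hP⟩ := isCompact_Icc.exists_bound_of_continuousOn hp
  obtain ⟨Q, hQ⟩ := isCompact_Icc.exists_bound_of_continuousOn
    (hg.continuous.comp_continuousOn hq)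
  refine ⟨max 0 (max Q (2 * M * P)), le_max_left _ _, fun t s ht hs hts => ?_⟩
  have hsub : Set.Icc t (t + s) ⊆ Set.Icc 0 T := Set.Icc_subset_Icc ht hts
  have htm : t ∈ Set.Icc t (t + s) := ⟨le_rfl, by linarith⟩
  have hsm : t + s ∈ Set.Icc t (t + s) := ⟨by linarith, le_rfl⟩
  have hP0 : 0 ≤ P := (norm_nonneg _).trans (hP t (hsub htm))
  have hQ0 : 0 ≤ Q := (norm_nonneg _).trans (hQ t (hsub htm))
  have hpq : ∀ τ ∈ Set.Icc t (t + s), ‖q τ - q t‖ ≤ P * s := fun τ hτ => by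
    refine ((convex_Icc 0 T).norm_image_sub_le_of_norm_hasDerivWithin_le h.position hP
      (hsub htm) (hsub hτ)).trans ?_
    gcongr
    rw [Real.norm_of_nonneg (by linarith [hτ.1])]
    linarith [hτ.2]
  have hpp : ∀ τ ∈ Set.Icc t (t + s), ‖p τ - p t‖ ≤ Q * s := fun τ hτ => by
    refine ((convex_Icc 0 T).norm_image_sub_le_of_norm_hasDerivWithin_le h.velocity
      (fun x hx => by rw [norm_neg]; exact hQ x hx) (hsub htm) (hsub hτ)).trans ?_
    gcongr
    rw [Real.norm_of_nonneg (by linarith [hτ.1])]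
    linarith [hτ.2]
  have e1 : ‖q (t + s) - (q t + s • p t)‖ ≤ Q * s ^ 2 := by
    have := (convex_Icc t (t + s)).norm_image_sub_le_of_norm_hasDerivWithin_le
      (f := fun τ => q τ - τ • p t) (f' := fun τ => p τ - p t) (C := Q * s)
      (fun τ hτ => ((h.position τ (hsub hτ)).mono hsub).sub
        (by simpa using (hasDerivWithinAt_id τ (Set.Icc t (t + s))).smul_const (p t)))
      hpp htm hsm
    rw [add_sub_cancel_left, Real.norm_of_nonneg hs] at this
    calc _ = ‖q (t + s) - (t + s) • p t - (q t - t • p t)‖ := by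
          congr 1; rw [add_smul]; abel
      _ ≤ Q * s * s := this
      _ = _ := by ring
  have e2 : ‖p (t + s) - (p t - s • g (q t + s • p t))‖ ≤ 2 * M * P * s ^ 2 := by
    have := (convex_Icc t (t + s)).norm_image_sub_le_of_norm_hasDerivWithin_le
      (f := fun τ => p τ + τ • g (q t + s • p t))
      (f' := fun τ => -g (q τ) + g (q t + s • p t)) (C := 2 * M * P * s)
      (fun τ hτ => ((h.velocity τ (hsub hτ)).mono hsub).add
        (by simpa using
          (hasDerivWithinAt_id τ (Set.Icc t (t + s))).smul_const (g (q t + s • p t))))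
      (fun τ hτ => by
        rw [neg_add_eq_sub, norm_sub_rev]
        refine (hg.norm_sub_le _ _).trans ?_
        have h1 : ‖q τ - (q t + s • p t)‖ ≤ P * s + s * P := by
          rw [← sub_sub]
          refine (norm_sub_le _ _).trans (add_le_add (hpq τ hτ) ?_)
          rw [norm_smul, Real.norm_of_nonneg hs]
          gcongr
          exact hP t (hsub htm)
        calc _ ≤ M * (P * s + s * P) := by gcongr
          _ = _ := by ring) htm hsm
    rw [add_sub_cancel_left, Real.norm_of_nonneg hs] at this
    calc _ = ‖p (t + s) + (t + s) • g (q t + s • p t) - (p t + t • g (q t + s • p t))‖ := by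
          congr 1; rw [add_smul]; abel
      _ ≤ 2 * M * P * s * s := this
      _ = _ := by ring
  rw [dist_comm, Prod.dist_eq]
  refine max_le ?_ ?_
  · rw [dist_eq_norm]
    refine e1.trans ?_
    gcongr
    exact (le_max_left _ _).trans (le_max_right _ _)
  · rw [dist_eq_norm]
    refine e2.trans ?_
    gcongr
    exact (le_max_right _ _).trans (le_max_right _ _)

/-- Convergence of the symplectic Euler scheme. -/
theorem IsHamiltonianFlow.tendsto_symplecticEuler (hg : LipschitzWith M g) (hT : 0 ≤ T)
    {Φ : E × E → E × E} (hΦ : IsHamiltonianFlow g T Φ) (z : E × E) :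
    Filter.Tendsto (fun n : ℕ => (symplecticEuler g (T / (n + 1 : ℕ)))^[n + 1] z) Filter.atTop
      (nhds (Φ z)) := by
  obtain ⟨q, p, h, h0, h1⟩ := hΦ z
  obtain ⟨C, hC, hloc⟩ := h.exists_local_error hg
  set K : ℝ := 1 + M * (1 + T) with hK
  have hK0 : 0 ≤ K := by positivity
  have hbound : ∀ n : ℕ, dist ((symplecticEuler g (T / (n + 1 : ℕ)))^[n + 1] z) (Φ z) ≤
      C * T ^ 2 * Real.exp (K * T) / (n + 1 : ℕ) := by
    intro n
    set N := n + 1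
    have hN : (0 : ℝ) < N := by simp only [N]; positivity
    set s := T / N with hs
    have hs0 : 0 ≤ s := by positivity
    have hNs : N * s = T := by rw [hs]; field_simp
    have hsT : s ≤ T := by
      rw [hs, div_le_iff₀ hN]
      have : (1 : ℝ) ≤ N := by exact_mod_cast Nat.succ_le_succ (Nat.zero_le n)
      nlinarith
    -- After `k` steps there are `k` local errors of size `C s²`, each amplified by at most `exp (K
    -- k s)`.
    have ind : ∀ k : ℕ, k ≤ N → dist ((symplecticEuler g s)^[k] z) (q (k * s), p (k * s)) ≤
        k * (C * s ^ 2) * Real.exp (K * (k * s)) := by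
      intro k
      induction k with
      | zero => intro _; simp [h0]
      | succ k ih =>
        intro hk
        have ih := ih (by omega)
        have hkT : (k * s : ℝ) + s ≤ T := by
          rw [← hNs]
          have : ((k : ℝ) + 1) ≤ N := by exact_mod_cast hk
          nlinarith
        have he : ((k + 1 : ℕ) : ℝ) * s = k * s + s := by push_cast; ring
        rw [Function.iterate_succ_apply', he]
        have a1 := hloc (k * s) s (by positivity) hs0 hkT
        have a2 := dist_symplecticEuler_le hg hs0 hsT ((symplecticEuler g s)^[k] z)
          (q (k * s), p (k * s))
        rw [← hK] at a2
        have a3 : Real.exp (K * s) * dist ((symplecticEuler g s)^[k] z) (q (k * s), p (k * s)) ≤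
            Real.exp (K * s) * (k * (C * s ^ 2) * Real.exp (K * (k * s))) := by gcongr
        have a4 : Real.exp (K * (k * s + s)) = Real.exp (K * s) * Real.exp (K * (k * s)) := by
          rw [← Real.exp_add]; ring_nf
        have a5 : C * s ^ 2 ≤ C * s ^ 2 * Real.exp (K * (k * s + s)) := by
          refine le_mul_of_one_le_right (by positivity) (Real.one_le_exp (by positivity))
        refine (dist_triangle _ _ _).trans ((add_le_add a2 a1).trans ?_)
        push_cast
        rw [a4] at a5 ⊢
        linarith
    have := ind N le_rfl
    rw [hNs, h1] at this
    refine this.trans (le_of_eq ?_)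
    rw [hs]; field_simp
  refine tendsto_iff_dist_tendsto_zero.2 (squeeze_zero (fun _ => dist_nonneg) hbound ?_)
  exact (tendsto_const_div_atTop_nhds_zero_nat _).comp (Filter.tendsto_add_atTop_nat 1)

end HamiltonianFlow

/-! ### Invariance of the Gibbs measure times the Gaussian -/

section Stationarity

/-- A pointwise limit of `μ`-preserving maps which leaves the continuous density `ρ` invariant
preserves the finite measure `ρ μ`. -/
theorem MeasureTheory.MeasurePreserving.withDensity_of_tendsto {X : Type*} [TopologicalSpace X]
    [MeasurableSpace X] [BorelSpace X] [HasOuterApproxClosed X] {μ : Measure X} {ρ : X → ℝ≥0}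
    (hρ : Continuous ρ) [IsFiniteMeasure (μ.withDensity fun x => (ρ x : ℝ≥0∞))]
    {S : ℕ → X → X} (hS : ∀ n, MeasurePreserving (S n) μ μ) {Φ : X → X} (hΦ : Measurable Φ)
    (hlim : ∀ x, Filter.Tendsto (fun n => S n x) Filter.atTop (nhds (Φ x)))
    (hρΦ : ∀ x, ρ (Φ x) = ρ x) :
    MeasurePreserving Φ (μ.withDensity fun x => (ρ x : ℝ≥0∞))
      (μ.withDensity fun x => (ρ x : ℝ≥0∞)) := by
  set ν := μ.withDensity fun x => (ρ x : ℝ≥0∞) with hν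
  have hρm : Measurable fun x => (ρ x : ℝ≥0∞) := hρ.measurable.coe_nnreal_ennreal
  -- Fatou along `S n`: the integrands `(ρ F) ∘ S n` have constant integral and converge to `ρ · (F
  -- ∘ Φ)`, because `ρ ∘ Φ = ρ`.
  have hle : ∀ F : BoundedContinuousFunction X ℝ≥0, ∫⁻ x, F (Φ x) ∂ν ≤ ∫⁻ x, F x ∂ν := by
    intro F
    have hFm : Measurable fun x => (F x : ℝ≥0∞) := F.continuous.measurable.coe_nnreal_ennreal
    have hFΦ : Measurable fun x => (F (Φ x) : ℝ≥0∞) := hFm.comp hΦ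
    have hm : Measurable fun x => ((ρ x * F x : ℝ≥0) : ℝ≥0∞) :=
      (hρ.mul F.continuous).measurable.coe_nnreal_ennreal
    rw [hν, lintegral_withDensity_eq_lintegral_mul _ hρm hFΦ,
      lintegral_withDensity_eq_lintegral_mul _ hρm hFm]
    calc ∫⁻ x, ((fun x => (ρ x : ℝ≥0∞)) * fun x => (F (Φ x) : ℝ≥0∞)) x ∂μ
        = ∫⁻ x, Filter.liminf (fun n => ((ρ (S n x) * F (S n x) : ℝ≥0) : ℝ≥0∞))
            Filter.atTop ∂μ := by
          refine lintegral_congr fun x => ?_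
          have : Filter.Tendsto (fun n => ((ρ (S n x) * F (S n x) : ℝ≥0) : ℝ≥0∞)) Filter.atTop
              (nhds ((ρ (Φ x) * F (Φ x) : ℝ≥0) : ℝ≥0∞)) :=
            ENNReal.tendsto_coe.2 (((hρ.mul F.continuous).tendsto _).comp (hlim x))
          rw [this.liminf_eq, hρΦ]
          simp
      _ ≤ Filter.liminf (fun n => ∫⁻ x, ((ρ (S n x) * F (S n x) : ℝ≥0) : ℝ≥0∞) ∂μ)
            Filter.atTop := lintegral_liminf_le fun n => hm.comp (hS n).measurable
      _ = ∫⁻ x, ((fun x => (ρ x : ℝ≥0∞)) * fun x => (F x : ℝ≥0∞)) x ∂μ := by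
          have : ∀ n, ∫⁻ x, ((ρ (S n x) * F (S n x) : ℝ≥0) : ℝ≥0∞) ∂μ =
              ∫⁻ x, ((ρ x * F x : ℝ≥0) : ℝ≥0∞) ∂μ := fun n => (hS n).lintegral_comp hm
          simp only [this, Filter.liminf_const]
          simp only [Pi.mul_apply, ENNReal.coe_mul]
  refine ⟨hΦ, Eq.symm (ext_of_forall_lintegral_eq_of_IsFiniteMeasure fun F => ?_)⟩
  have hFm : Measurable fun x => (F x : ℝ≥0∞) := F.continuous.measurable.coe_nnreal_ennreal
  have hFΦ : Measurable fun x => (F (Φ x) : ℝ≥0∞) := hFm.comp hΦ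
  rw [lintegral_map hFm hΦ]
  -- The reverse inequality is `hle` for the complement `c - F`, the total mass being finite.
  set c : ℝ≥0 := nndist F 0
  have hFc : ∀ x, F x ≤ c := BoundedContinuousFunction.NNReal.upper_bound F
  set G : BoundedContinuousFunction X ℝ≥0 := BoundedContinuousFunction.const X c - F
  have hG : ∀ x, (G x : ℝ≥0∞) + F x = c := fun x => by
    rw [← ENNReal.coe_add]
    congr 1
    exact tsub_add_cancel_of_le (hFc x)
  have s1 : ∫⁻ x, G x ∂ν + ∫⁻ x, F x ∂ν = c * ν Set.univ := by
    rw [← lintegral_add_right _ hFm]; simp [hG]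
  have s2 : ∫⁻ x, G (Φ x) ∂ν + ∫⁻ x, F (Φ x) ∂ν = c * ν Set.univ := by
    rw [← lintegral_add_right _ hFΦ]; simp [hG]
  have hfin : c * ν Set.univ ≠ ∞ := ENNReal.mul_ne_top ENNReal.coe_ne_top (measure_ne_top _ _)
  refine le_antisymm ?_ (hle F)
  have hGfin : ∫⁻ x, G x ∂ν ≠ ∞ := ne_top_of_le_ne_top hfin (s1 ▸ le_self_add)
  refine (ENNReal.add_le_add_iff_left hGfin).1 ?_
  rw [s1, ← s2]
  exact add_le_add_left (hle G) _

variable {E : Type*} [NormedAddCommGroup E] [InnerProductSpace ℝ E] [FiniteDimensional ℝ E]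
  [MeasurableSpace E] [BorelSpace E]

/-- Each half-step is a shear: it translates one coordinate by a function of the other. The swaps
let the skew product lemma treat the position update as well. -/
theorem measurePreserving_symplecticEuler {g : E → E} (hg : Continuous g) (s : ℝ) :
    MeasurePreserving (symplecticEuler g s) ((volume : Measure E).prod volume)
      ((volume : Measure E).prod volume) := by
  have h1 : MeasurePreserving (fun z : E × E => (z.1, z.2 + s • z.1))
      ((volume : Measure E).prod volume) ((volume : Measure E).prod volume) :=
    (MeasurePreserving.id volume).skew_product (g := fun x y => y + s • x) (by fun_prop)
      (Filter.Eventually.of_forall fun x => (measurePreserving_add_right volume _).map_eq)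
  have h2 : MeasurePreserving (fun z : E × E => (z.1, z.2 - s • g z.1))
      ((volume : Measure E).prod volume) ((volume : Measure E).prod volume) :=
    (MeasurePreserving.id volume).skew_product (g := fun x y => y - s • g x)
      (by
        have := hg.measurable
        fun_prop)
      (Filter.Eventually.of_forall fun x => (measurePreserving_sub_right volume _).map_eq)
  have h3 := Measure.measurePreserving_swap (μ := (volume : Measure E)) (ν := (volume : Measure E))
  exact h2.comp (h3.comp (h1.comp h3))

theorem integrable_exp_neg_mul_norm_sq {b : ℝ} (hb : 0 < b) :
    Integrable (fun v : E => Real.exp (-(b * ‖v‖ ^ 2))) := by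
  have := GaussianFourier.integrable_cexp_neg_mul_sq_norm_add (V := E) (b := b)
    (by simpa using hb) 0 0
  refine (this.norm).congr (Filter.Eventually.of_forall fun v => ?_)
  simp only [Complex.norm_exp]
  congr 1
  rw [← Complex.ofReal_pow]
  simp [-Complex.ofReal_pow]

theorem integrable_exp_neg_norm_sq_div_two :
    Integrable (fun v : E => Real.exp (-(‖v‖ ^ 2 / 2))) := by
  convert! integrable_exp_neg_mul_norm_sq (E := E) (b := 1 / 2) (by norm_num) using 4
  ring

/-- Characteristic functions agree. The density form makes the product with the Gibbs measure a
function of the energy alone. -/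
theorem stdGaussian_eq_tilted :
    stdGaussian E = (volume : Measure E).tilted fun v => -(‖v‖ ^ 2 / 2) := by
  have hint := integrable_exp_neg_norm_sq_div_two (E := E)
  have : IsProbabilityMeasure ((volume : Measure E).tilted fun v => -(‖v‖ ^ 2 / 2)) :=
    isProbabilityMeasure_tilted hint
  refine Measure.ext_of_charFun ?_
  ext t
  have hZ : ((∫ v : E, Real.exp (-(‖v‖ ^ 2 / 2)) : ℝ) : ℂ) =
      (Real.pi / (1 / 2 : ℂ)) ^ (Module.finrank ℝ E / 2 : ℂ) := by
    rw [← GaussianFourier.integral_cexp_neg_mul_sq_norm (V := E) (b := 1 / 2) (by norm_num),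
      ← integral_complex_ofReal]
    congr with v
    push_cast
    ring_nf
  have hZ0 : ((∫ v : E, Real.exp (-(‖v‖ ^ 2 / 2)) : ℝ) : ℂ) ≠ 0 :=
    Complex.ofReal_ne_zero.2 (integral_exp_pos hint).ne'
  have hF := GaussianFourier.integral_cexp_neg_mul_sq_norm_add (V := E) (b := 1 / 2)
    (by norm_num) Complex.I t
  rw [charFun_stdGaussian, charFun_apply, integral_tilted]
  rw [← hZ] at hF
  have : ∀ v : E, (Real.exp (-(‖v‖ ^ 2 / 2)) / ∫ v : E, Real.exp (-(‖v‖ ^ 2 / 2))) •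
      Complex.exp (inner ℝ v t * Complex.I) =
      ((∫ v : E, Real.exp (-(‖v‖ ^ 2 / 2)) : ℝ) : ℂ)⁻¹ *
        Complex.exp (-(1 / 2) * ‖v‖ ^ 2 + Complex.I * inner ℝ t v) := fun v => by
    rw [Complex.real_smul, Complex.ofReal_div, Complex.ofReal_exp, div_eq_inv_mul, mul_assoc,
      ← Complex.exp_add, real_inner_comm]
    congr 2
    push_cast
    ring
  simp only [this]
  rw [integral_const_mul, hF, inv_mul_cancel_left₀ hZ0]
  congr 1
  rw [Complex.I_sq]
  ring

/-- The Hamiltonian flow preserves the product of the Gibbs measure and the standard Gaussian. -/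
theorem IsHamiltonianFlow.measurePreserving {f : E → ℝ} {M : ℝ≥0} {T : ℝ}
    (hf : Differentiable ℝ f) (hL : LipschitzWith M (∇ f)) (hT : 0 ≤ T)
    (hint : Integrable fun x => Real.exp (-f x))
    {Φ : E × E → E × E} (hΦ : IsHamiltonianFlow (∇ f) T Φ) :
    MeasurePreserving Φ (((volume : Measure E).tilted fun x => -f x).prod (stdGaussian E))
      (((volume : Measure E).tilted fun x => -f x).prod (stdGaussian E)) := by
  have hint' := integrable_exp_neg_norm_sq_div_two (E := E)
  have : IsProbabilityMeasure ((volume : Measure E).tilted fun x => -f x) :=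
    isProbabilityMeasure_tilted hint
  set Z₁ := ∫ x : E, Real.exp (-f x)
  set Z₂ := ∫ v : E, Real.exp (-(‖v‖ ^ 2 / 2))
  have hZ₁ : 0 < Z₁ := integral_exp_pos hint
  have hZ₂ : 0 < Z₂ := integral_exp_pos hint'
  set ρ : E × E → ℝ≥0 := fun z =>
    (Real.exp (-(f z.1 + ‖z.2‖ ^ 2 / 2)) / (Z₁ * Z₂)).toNNReal
  have hν : ((volume : Measure E).tilted fun x => -f x).prod (stdGaussian E) =
      ((volume : Measure E).prod volume).withDensity fun z => (ρ z : ℝ≥0∞) := by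
    have hfm := hf.continuous.measurable
    rw [stdGaussian_eq_tilted, Measure.tilted, Measure.tilted,
      prod_withDensity (by fun_prop) (by fun_prop)]
    congr with z
    rw [← ENNReal.ofReal_mul (by positivity)]
    change _ = ENNReal.ofReal _
    congr 1
    rw [div_mul_div_comm, ← Real.exp_add, neg_add]
  have hprob := (inferInstance :
    IsProbabilityMeasure (((volume : Measure E).tilted fun x => -f x).prod (stdGaussian E)))
  rw [hν] at hprob ⊢
  refine MeasurePreserving.withDensity_of_tendsto ?_
    (S := fun n : ℕ => (symplecticEuler (∇ f) (T / (n + 1 : ℕ)))^[n + 1])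
    (fun n => (measurePreserving_symplecticEuler hL.continuous _).iterate _)
    (hΦ.continuous hL hT).measurable (hΦ.tendsto_symplecticEuler hL hT) (fun z => ?_)
  · have := hf.continuous
    fun_prop
  · simp only [ρ, hΦ.energy_eq hf hT z]

end Stationarity

/-! ### Integrability and second moment of the Gibbs measure -/

section GibbsMoments

variable {E : Type*} [NormedAddCommGroup E] [InnerProductSpace ℝ E] [FiniteDimensional ℝ E]
  [MeasurableSpace E] [BorelSpace E] {f : E → ℝ} {m : ℝ} {M : ℝ≥0}

/-- Young's inequality spends half of the quadratic term `m / 2` on the linear one. Of the remaining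
Gaussian decay `m / 4`, one half absorbs the polynomial and the other is integrable. -/
theorem StrongConvexOn.integrable_one_add_norm_sq_mul_exp_neg
    (hc : StrongConvexOn Set.univ m f) (hm : 0 < m) (hf : Differentiable ℝ f) (x : E) :
    Integrable fun y => (1 + ‖y - x‖ ^ 2) * Real.exp (-f y) := by
  have hm4 : 0 < m / 8 := by positivity
  have h1 := ((integrable_exp_neg_mul_norm_sq (E := E) hm4).comp_sub_right x).const_mul
    ((1 + 8 / m) * Real.exp (-f x + ‖∇ f x‖ ^ 2 / m))
  refine h1.mono' ?_ (Filter.Eventually.of_forall fun y => ?_)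
  · have := hf.continuous
    exact (by fun_prop : Continuous fun y => (1 + ‖y - x‖ ^ 2) * Real.exp (-f y))
      |>.aestronglyMeasurable
  rw [Real.norm_of_nonneg (by positivity)]
  have h2 := hc.add_inner_gradient_le hf x y
  have h3 := neg_le_of_abs_le (abs_real_inner_le_norm (∇ f x) (y - x))
  have h4 : ‖∇ f x‖ * ‖y - x‖ ≤ ‖∇ f x‖ ^ 2 / m + m / 4 * ‖y - x‖ ^ 2 := by
    have : 0 ≤ (‖∇ f x‖ - m / 2 * ‖y - x‖) ^ 2 / m := by positivity
    have e : (‖∇ f x‖ - m / 2 * ‖y - x‖) ^ 2 / m =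
        ‖∇ f x‖ ^ 2 / m + m / 4 * ‖y - x‖ ^ 2 - ‖∇ f x‖ * ‖y - x‖ := by
      field_simp; ring
    linarith
  have h5 : 1 + ‖y - x‖ ^ 2 ≤ (1 + 8 / m) * Real.exp (m / 8 * ‖y - x‖ ^ 2) := by
    have a1 := Real.add_one_le_exp (m / 8 * ‖y - x‖ ^ 2)
    have a2 : 8 / m * (m / 8 * ‖y - x‖ ^ 2) = ‖y - x‖ ^ 2 := by field_simp
    have a3 : 0 ≤ m / 8 * ‖y - x‖ ^ 2 := by positivity
    have a4 : 8 / m * (m / 8 * ‖y - x‖ ^ 2) ≤ 8 / m * Real.exp (m / 8 * ‖y - x‖ ^ 2) := by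
      gcongr; linarith
    linarith
  have h6 : Real.exp (-f y) ≤
      Real.exp (-f x + ‖∇ f x‖ ^ 2 / m + -(m / 4 * ‖y - x‖ ^ 2)) :=
    Real.exp_le_exp.2 (by linarith)
  calc (1 + ‖y - x‖ ^ 2) * Real.exp (-f y)
      ≤ ((1 + 8 / m) * Real.exp (m / 8 * ‖y - x‖ ^ 2)) *
        Real.exp (-f x + ‖∇ f x‖ ^ 2 / m + -(m / 4 * ‖y - x‖ ^ 2)) := by gcongr
    _ = (1 + 8 / m) * (Real.exp (-f x + ‖∇ f x‖ ^ 2 / m) *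
        Real.exp (-(m / 8 * ‖y - x‖ ^ 2))) := by
      rw [mul_assoc, ← Real.exp_add, ← Real.exp_add]
      ring_nf
    _ = _ := by ring

theorem StrongConvexOn.integrable_exp_neg
    (hc : StrongConvexOn Set.univ m f) (hm : 0 < m) (hf : Differentiable ℝ f) :
    Integrable fun y => Real.exp (-f y) := by
  refine (hc.integrable_one_add_norm_sq_mul_exp_neg hm hf 0).mono'
    (Real.continuous_exp.comp hf.continuous.neg).aestronglyMeasurable
    (Filter.Eventually.of_forall fun y => ?_)
  rw [Real.norm_of_nonneg (by positivity)]
  refine le_mul_of_one_le_left (by positivity) ?_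
  have : 0 ≤ ‖y - 0‖ ^ 2 := by positivity
  linarith

theorem StrongConvexOn.integrable_norm_sq_mul_exp_neg
    (hc : StrongConvexOn Set.univ m f) (hm : 0 < m) (hf : Differentiable ℝ f) (x : E) :
    Integrable fun y => ‖y - x‖ ^ 2 * Real.exp (-f y) := by
  convert! (hc.integrable_one_add_norm_sq_mul_exp_neg hm hf x).sub (hc.integrable_exp_neg hm hf)
    using 2 with y
  simp; ring

/-- Integration by parts against the Gibbs density, `E ⟪∇f(Y), Y - x⟫ = dim E`. -/
theorem StrongConvexOn.integral_inner_gradient_mul_exp_neg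
    (hc : StrongConvexOn Set.univ m f) (hm : 0 < m) (hf : Differentiable ℝ f)
    (hL : LipschitzWith M (∇ f)) (x : E) :
    (Integrable fun y => inner ℝ (∇ f y) (y - x) * Real.exp (-f y)) ∧
      ∫ y, inner ℝ (∇ f y) (y - x) * Real.exp (-f y) =
        Module.finrank ℝ E * ∫ y, Real.exp (-f y) := by
  have hI := hc.integrable_one_add_norm_sq_mul_exp_neg hm hf x
  have hgc := hL.continuous
  have hfc := hf.continuous
  set b := stdOrthonormalBasis ℝ E
  have hgrow : ∀ y, ‖∇ f y‖ * ‖y - x‖ ≤ (‖∇ f x‖ + M) * (1 + ‖y - x‖ ^ 2) := fun y => by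
    have h1 := hL.norm_sub_le y x
    have h2 := norm_le_insert' (∇ f y) (∇ f x)
    have h3 : ‖y - x‖ ≤ 1 + ‖y - x‖ ^ 2 := by nlinarith [sq_nonneg (‖y - x‖ - 1)]
    have h4 : ‖∇ f y‖ * ‖y - x‖ ≤ (‖∇ f x‖ + M * ‖y - x‖) * ‖y - x‖ := by
      gcongr; linarith
    have h5 : ‖∇ f x‖ * ‖y - x‖ ≤ ‖∇ f x‖ * (1 + ‖y - x‖ ^ 2) := by gcongr
    have h6 : 0 ≤ (M : ℝ) := M.2
    linarith
  -- Integration by parts in the direction `b i`: the derivative of `⟪b i, y - x⟫` is `1`, so each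
  -- basis direction contributes one copy of the normalizing constant.
  have hterm : ∀ i, (Integrable fun y =>
        inner ℝ (∇ f y) (b i) * inner ℝ (b i) (y - x) * Real.exp (-f y)) ∧
      ∫ y, inner ℝ (∇ f y) (b i) * inner ℝ (b i) (y - x) * Real.exp (-f y) =
        ∫ y, Real.exp (-f y) := by
    intro i
    have hint : Integrable fun y =>
        inner ℝ (∇ f y) (b i) * inner ℝ (b i) (y - x) * Real.exp (-f y) := by
      refine (hI.const_mul (‖∇ f x‖ + M)).mono' (by
        exact (by fun_prop : Continuous fun y =>
          inner ℝ (∇ f y) (b i) * inner ℝ (b i) (y - x) * Real.exp (-f y)).aestronglyMeasurable)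
        (Filter.Eventually.of_forall fun y => ?_)
      rw [norm_mul, Real.norm_of_nonneg (Real.exp_pos _).le, ← mul_assoc, norm_mul]
      refine mul_le_mul_of_nonneg_right (le_trans ?_ (hgrow y)) (Real.exp_pos _).le
      gcongr
      · simpa using norm_inner_le_norm (𝕜 := ℝ) (∇ f y) (b i)
      · simpa using norm_inner_le_norm (𝕜 := ℝ) (b i) (y - x)
    refine ⟨hint, ?_⟩
    have hdu : ∀ y, HasFDerivAt (fun y => inner ℝ (b i) (y - x)) (innerSL ℝ (b i)) y :=
      fun y => (innerSL ℝ (b i)).hasFDerivAt.comp y ((hasFDerivAt_id y).sub_const x)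
    have hde : ∀ y, HasFDerivAt (fun y => Real.exp (-f y))
        (Real.exp (-f y) • -(InnerProductSpace.toDual ℝ E (∇ f y))) y :=
      fun y => (hf y).hasGradientAt.hasFDerivAt.neg.exp
    have hd1 : ∀ y, fderiv ℝ (fun y => Real.exp (-f y)) y (b i) =
        -(inner ℝ (∇ f y) (b i) * Real.exp (-f y)) := fun y => by
      rw [(hde y).fderiv]; simp [mul_comm]
    have hd2 : ∀ y, fderiv ℝ (fun y => inner ℝ (b i) (y - x)) y (b i) = 1 := fun y => by
      rw [(hdu y).fderiv]; simp
    have key := integral_mul_fderiv_eq_neg_fderiv_mul_of_integrable (μ := (volume : Measure E))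
      (f := fun y => inner ℝ (b i) (y - x)) (g := fun y => Real.exp (-f y)) (v := b i)
      (by simpa only [hd2, one_mul] using hc.integrable_exp_neg hm hf)
      (by
        simp only [hd1]
        convert! hint.neg using 2 with y
        simp; ring)
      (by
        refine hI.mono' (by
          exact (by fun_prop : Continuous fun y =>
            inner ℝ (b i) (y - x) * Real.exp (-f y)).aestronglyMeasurable)
          (Filter.Eventually.of_forall fun y => ?_)
        rw [norm_mul, Real.norm_of_nonneg (Real.exp_pos _).le]
        gcongr
        have h1 : ‖inner ℝ (b i) (y - x)‖ ≤ ‖y - x‖ := by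
          simpa using norm_inner_le_norm (𝕜 := ℝ) (b i) (y - x)
        nlinarith [sq_nonneg (‖y - x‖ - 1)])
      (fun y _ => (hdu y).differentiableAt) (fun y _ => (hde y).differentiableAt)
    simp only [hd1, hd2, one_mul] at key
    rw [← neg_inj, ← key, ← integral_neg]
    congr with y
    ring
  have hsum : (fun y => inner ℝ (∇ f y) (y - x) * Real.exp (-f y)) =
      fun y => ∑ i, inner ℝ (∇ f y) (b i) * inner ℝ (b i) (y - x) * Real.exp (-f y) := by
    ext y
    rw [← Finset.sum_mul, b.sum_inner_mul_inner]
  rw [hsum]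
  refine ⟨integrable_finsetSum _ fun i _ => (hterm i).1, ?_⟩
  rw [integral_finsetSum _ fun i _ => (hterm i).1]
  simp only [fun i => (hterm i).2]
  simp

/-- The second moment of the Gibbs measure around an arbitrary point. -/
theorem StrongConvexOn.integral_norm_sub_sq_tilted_le
    (hc : StrongConvexOn Set.univ m f) (hm : 0 < m) (hf : Differentiable ℝ f)
    (hL : LipschitzWith M (∇ f)) (x : E) :
    Integrable (fun y => ‖y - x‖ ^ 2) ((volume : Measure E).tilted fun y => -f y) ∧
      ∫ y, ‖y - x‖ ^ 2 ∂((volume : Measure E).tilted fun y => -f y) ≤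
        2 * (‖∇ f x‖ ^ 2 / m + Module.finrank ℝ E) / m := by
  have hI0 := hc.integrable_exp_neg hm hf
  have hI2 := hc.integrable_norm_sq_mul_exp_neg hm hf x
  obtain ⟨hI1, hibp⟩ := hc.integral_inner_gradient_mul_exp_neg hm hf hL x
  set Z := ∫ y, Real.exp (-f y)
  have hZ : 0 < Z := integral_exp_pos hI0
  constructor
  · rw [integrable_tilted_iff hI0]
    simpa only [smul_eq_mul, mul_comm] using hI2
  -- Strong monotonicity between `y` and `x` is integrated. Young's inequality for the `∇ f x` term
  -- costs half of `m ‖y - x‖²`, and `hibp` evaluates the other inner product.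
  have hmain : m / 2 * ∫ y, ‖y - x‖ ^ 2 * Real.exp (-f y) ≤
      Module.finrank ℝ E * Z + ‖∇ f x‖ ^ 2 / (2 * m) * Z := by
    rw [← hibp, ← integral_const_mul, ← integral_const_mul, ← integral_add hI1 (hI0.const_mul _)]
    refine integral_mono (hI2.const_mul _) (hI1.add (hI0.const_mul _)) fun y => ?_
    have h1 := hc.inner_gradient_sub_ge hf y x
    have h2 := neg_le_of_abs_le (abs_real_inner_le_norm (∇ f x) (y - x))
    have h3 : ‖∇ f x‖ * ‖y - x‖ ≤ ‖∇ f x‖ ^ 2 / (2 * m) + m / 2 * ‖y - x‖ ^ 2 := by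
      have : 0 ≤ (‖∇ f x‖ - m * ‖y - x‖) ^ 2 / (2 * m) := by positivity
      have e : (‖∇ f x‖ - m * ‖y - x‖) ^ 2 / (2 * m) =
          ‖∇ f x‖ ^ 2 / (2 * m) + m / 2 * ‖y - x‖ ^ 2 - ‖∇ f x‖ * ‖y - x‖ := by
        field_simp; ring
      linarith
    rw [inner_sub_left] at h1
    change m / 2 * (‖y - x‖ ^ 2 * Real.exp (-f y)) ≤
      inner ℝ (∇ f y) (y - x) * Real.exp (-f y) + ‖∇ f x‖ ^ 2 / (2 * m) * Real.exp (-f y)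
    rw [← mul_assoc, ← add_mul]
    gcongr
    linarith
  rw [integral_tilted]
  have : ∫ y, (Real.exp (-f y) / Z) • ‖y - x‖ ^ 2 =
      Z⁻¹ * ∫ y, ‖y - x‖ ^ 2 * Real.exp (-f y) := by
    rw [← integral_const_mul]
    congr with y
    rw [smul_eq_mul]; ring
  change ∫ y, (Real.exp (-f y) / Z) • ‖y - x‖ ^ 2 ≤ _
  rw [this, inv_mul_le_iff₀ hZ]
  have h4 : 2 * (‖∇ f x‖ ^ 2 / m + Module.finrank ℝ E) / m * (m / 2) =
      ‖∇ f x‖ ^ 2 / m + Module.finrank ℝ E := by field_simp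
  have h5 : ‖∇ f x‖ ^ 2 / (2 * m) ≤ ‖∇ f x‖ ^ 2 / m := by gcongr; linarith
  have h6 : ‖∇ f x‖ ^ 2 / (2 * m) * Z ≤ ‖∇ f x‖ ^ 2 / m * Z := by gcongr
  have h7 : 0 < m / 2 := by positivity
  refine le_of_mul_le_mul_left ?_ h7
  calc _ ≤ _ := hmain
    _ ≤ (‖∇ f x‖ ^ 2 / m + Module.finrank ℝ E) * Z := by linarith
    _ = 2 * (‖∇ f x‖ ^ 2 / m + Module.finrank ℝ E) / m * (m / 2) * Z := by rw [h4]
    _ = _ := by ring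

end GibbsMoments

/-! ### Synchronous coupling with the stationary chain -/

section Coupling

theorem wassersteinDist_two_le_of_isCoupling {E : Type*} [NormedAddCommGroup E]
    [MeasurableSpace E] {μ ν : Measure E} {γ : Measure (E × E)} (hγ : IsCoupling μ ν γ) {r : ℝ}
    (hr : 0 ≤ r) (h : ∫⁻ z, ‖z.1 - z.2‖ₑ ^ 2 ∂γ ≤ ENNReal.ofReal (r ^ 2)) :
    wassersteinDist 2 μ ν ≤ ENNReal.ofReal r := by
  have h1 : (⨅ (γ : Measure (E × E)) (_ : IsCoupling μ ν γ), ∫⁻ z, ‖z.1 - z.2‖ₑ ^ 2 ∂γ) ≤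
      ENNReal.ofReal (r ^ 2) := (iInf₂_le γ hγ).trans h
  refine (ENNReal.rpow_le_rpow h1 (by positivity)).trans (le_of_eq ?_)
  rw [ENNReal.ofReal_rpow_of_nonneg (by positivity) (by positivity), ← Real.rpow_natCast r,
    ← Real.rpow_mul hr]
  norm_num

/-- The final point of the chain `y ↦ φ y v₀ ↦ φ (φ y v₀) v₁ ↦ ⋯`. -/
def iterateWithNoise {E V : Type*} (φ : E → V → E) : (n : ℕ) → E → (Fin n → V) → E
  | 0, y, _ => y
  | n + 1, y, v => iterateWithNoise φ n (φ y (v 0)) fun i => v i.succ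

/-- The first velocity is split off and used up by `φ`; the new position has law `π` and is
independent of the remaining velocities. -/
theorem measurePreserving_iterateWithNoise {E V : Type*} [MeasurableSpace E] [MeasurableSpace V]
    {π : Measure E} [IsProbabilityMeasure π] {γ : Measure V} [IsProbabilityMeasure γ]
    {φ : E → V → E} (hφ : MeasurePreserving (fun z : E × V => φ z.1 z.2) (π.prod γ) π) (n : ℕ) :
    MeasurePreserving (fun z : E × (Fin n → V) => iterateWithNoise φ n z.1 z.2)
      (π.prod (Measure.pi fun _ => γ)) π := by
  induction n with
  | zero => exact measurePreserving_fst
  | succ n ih =>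
    have h1 := (MeasurePreserving.id π).prod
      (measurePreserving_piFinSuccAbove (fun _ : Fin (n + 1) => γ) 0)
    have h2 := (measurePreserving_prodAssoc π γ (Measure.pi fun _ : Fin n => γ)).symm
    have h3 := hφ.prod (MeasurePreserving.id (Measure.pi fun _ : Fin n => γ))
    exact ih.comp (h3.comp (h2.comp h1))

/-- One step turns a distance `a` into at most `c a + (1 - c) b`, a recursion with fixed point `b`.
-/
theorem norm_sub_iterateWithNoise_le {E V : Type*} [NormedAddCommGroup E] {φ : E → V → E}
    {c b : ℝ} (hc : 0 ≤ c) (hφ : ∀ y y' v, ‖φ y v - φ y' v‖ ≤ c * ‖y - y'‖) (n : ℕ)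
    (x : Fin (n + 1) → E) (v : Fin n → V) (y : E)
    (hx : ∀ k : Fin n, ‖x k.succ - φ (x k.castSucc) (v k)‖ ≤ (1 - c) * b) :
    ‖x (Fin.last n) - iterateWithNoise φ n y v‖ ≤ c ^ n * ‖x 0 - y‖ + (1 - c ^ n) * b := by
  induction n generalizing y with
  | zero => simp [iterateWithNoise]
  | succ n ih =>
    have h1 := ih (fun k => x k.succ) (fun k => v k.succ) (φ y (v 0)) (fun k => by
      have := hx k.succ
      rwa [← Fin.succ_castSucc] at this)
    have h2 : ‖x (Fin.succ 0) - φ y (v 0)‖ ≤ c * ‖x 0 - y‖ + (1 - c) * b := by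
      have a1 := hx 0
      have a2 := hφ (x 0) y (v 0)
      rw [Fin.castSucc_zero] at a1
      have a3 := norm_sub_le_norm_sub_add_norm_sub (x (Fin.succ 0)) (φ (x 0) (v 0)) (φ y (v 0))
      linarith
    have h3 := mul_le_mul_of_nonneg_left h2 (pow_nonneg hc n)
    simp only [Fin.succ_last] at h1
    refine h1.trans ?_
    rw [pow_succ]
    linarith

/-- Synchronous coupling of a perturbed random iteration, started at a point, with the stationary
chain of a contracting random map. -/
theorem wassersteinDist_perturbed_iteration_le {E V : Type*} [NormedAddCommGroup E]
    [MeasurableSpace E] [BorelSpace E] [SecondCountableTopology E] [MeasurableSpace V]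
    {π : Measure E} [IsProbabilityMeasure π] {γ : Measure V} [IsProbabilityMeasure γ]
    {φ : E → V → E} (hφ : MeasurePreserving (fun z : E × V => φ z.1 z.2) (π.prod γ) π)
    {c b : ℝ} (hc : 0 ≤ c) (hc1 : c ≤ 1)
    (hcontr : ∀ y y' v, ‖φ y v - φ y' v‖ ≤ c * ‖y - y'‖)
    {Ω : Type*} [MeasurableSpace Ω] {P : Measure Ω} [IsProbabilityMeasure P] {n : ℕ}
    {v : Fin n → Ω → V} {x : Fin (n + 1) → Ω → E} {x₀ : E}
    (hlaw : ∀ k, HasLaw (v k) γ P) (hindep : iIndepFun v P) (hx : AEMeasurable (x (Fin.last n)) P)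
    (hx₀ : ∀ᵐ ω ∂P, x 0 ω = x₀)
    (hstep : ∀ k, ∀ᵐ ω ∂P, ‖x k.succ ω - φ (x k.castSucc ω) (v k ω)‖ ≤ (1 - c) * b)
    (hint : Integrable (fun y => ‖y - x₀‖ ^ 2) π) {r : ℝ} (hr : 0 ≤ r)
    (hbound : c ^ n * ∫ y, ‖y - x₀‖ ^ 2 ∂π + (1 - c ^ n) * b ^ 2 ≤ r ^ 2) :
    wassersteinDist 2 (P.map (x (Fin.last n))) π ≤ ENNReal.ofReal r := by
  have hcn : 0 ≤ c ^ n := pow_nonneg hc n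
  have hcn1 : c ^ n ≤ 1 := pow_le_one₀ hc hc1
  -- Measurable versions of the velocities, so that the stationary chain is a measurable function.
  set w : Fin n → Ω → V := fun k => (hlaw k).aemeasurable.mk (v k) with hw
  have hwm : ∀ k, Measurable (w k) := fun k => (hlaw k).aemeasurable.measurable_mk
  have hwv : ∀ᵐ ω ∂P, ∀ k, v k ω = w k ω :=
    ae_all_iff.2 fun k => (hlaw k).aemeasurable.ae_eq_mk
  have hW : MeasurePreserving (fun ω k => w k ω) P (Measure.pi fun _ => γ) := by
    refine ⟨measurable_pi_lambda _ hwm, ?_⟩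
    have h1 := (iIndepFun_iff_map_fun_eq_pi_map fun k => (hlaw k).aemeasurable).1 hindep
    simp only [fun k => (hlaw k).map_eq] at h1
    rw [← h1]
    refine Measure.map_congr ?_
    filter_upwards [hwv] with ω hω
    exact funext fun k => (hω k).symm
  -- The stationary chain lives on `Ω × E`: its starting point is independent of the run, and its
  -- velocities are those of the run.
  set Y : Ω × E → E := fun z => iterateWithNoise φ n z.2 fun k => w k z.1 with hY
  have hYm : MeasurePreserving Y (P.prod π) π :=
    (measurePreserving_iterateWithNoise hφ n).comp
      (Measure.measurePreserving_swap.comp (hW.prod (MeasurePreserving.id π)))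
  have hX : AEMeasurable (fun z : Ω × E => x (Fin.last n) z.1) (P.prod π) :=
    hx.comp_quasiMeasurePreserving Measure.quasiMeasurePreserving_fst
  refine wassersteinDist_two_le_of_isCoupling
    (γ := (P.prod π).map fun z => (x (Fin.last n) z.1, Y z)) ⟨?_, ?_⟩ hr ?_
  · rw [Measure.fst_map_prodMk₀ hYm.measurable.aemeasurable]
    have h1 : (P.prod π).map Prod.fst = P := measurePreserving_fst.map_eq
    conv_rhs => rw [← h1]
    rw [AEMeasurable.map_map_of_aemeasurable (by rwa [h1]) measurable_fst.aemeasurable]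
    rfl
  · rw [Measure.snd_map_prodMk₀ hX, hYm.map_eq]
  rw [lintegral_map' (by fun_prop) (hX.prodMk hYm.measurable.aemeasurable)]
  have hae : ∀ᵐ ω ∂P, x 0 ω = x₀ ∧ (∀ k, v k ω = w k ω) ∧
      ∀ k : Fin n, ‖x k.succ ω - φ (x k.castSucc ω) (v k ω)‖ ≤ (1 - c) * b := by
    filter_upwards [hx₀, hwv, ae_all_iff.2 hstep] with ω h1 h2 h3 using ⟨h1, h2, h3⟩
  have hpt : ∀ᵐ z ∂(P.prod π), ‖x (Fin.last n) z.1 - Y z‖ₑ ^ 2 ≤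
      ENNReal.ofReal (c ^ n * ‖z.2 - x₀‖ ^ 2 + (1 - c ^ n) * b ^ 2) := by
    filter_upwards [Measure.quasiMeasurePreserving_fst.ae hae] with z ⟨h1, h2, h3⟩
    have h4 := norm_sub_iterateWithNoise_le hc hcontr n (fun k => x k z.1) (fun k => w k z.1) z.2
      (fun k => by rw [← h2 k]; exact h3 k)
    rw [h1, norm_sub_rev x₀] at h4
    rw [← ofReal_norm, ← ENNReal.ofReal_pow (norm_nonneg _)]
    refine ENNReal.ofReal_le_ofReal ?_
    refine (pow_le_pow_left₀ (norm_nonneg _) h4 2).trans ?_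
    -- This term is the gap in the convexity inequality for the square, with weights `c ^ n` and `1
    -- - c ^ n`.
    have h5 : 0 ≤ c ^ n * (1 - c ^ n) * (‖z.2 - x₀‖ - b) ^ 2 :=
      mul_nonneg (mul_nonneg hcn (by linarith)) (sq_nonneg _)
    linarith
  refine (lintegral_mono_ae hpt).trans ?_
  have hint' : Integrable (fun y => c ^ n * ‖y - x₀‖ ^ 2 + (1 - c ^ n) * b ^ 2) π :=
    (hint.const_mul _).add (integrable_const _)
  rw [(measurePreserving_snd (μ := P) (ν := π)).lintegral_comp
    (f := fun y => ENNReal.ofReal (c ^ n * ‖y - x₀‖ ^ 2 + (1 - c ^ n) * b ^ 2)) (by fun_prop),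
    ← ofReal_integral_eq_lintegral_ofReal hint' (Filter.Eventually.of_forall fun y => by
      have : 0 ≤ 1 - c ^ n := by linarith
      positivity)]
  refine ENNReal.ofReal_le_ofReal ?_
  rw [integral_add (hint.const_mul _) (integrable_const _), integral_const_mul]
  simpa using hbound

end Coupling

/-! ### Parameters of the algorithm and the final estimates -/

section NoisyHMC

theorem StrongConvexOn.le_of_lipschitzWith_gradient {E : Type*} [NormedAddCommGroup E]
    [InnerProductSpace ℝ E] [CompleteSpace E] [Nontrivial E] {f : E → ℝ} {m : ℝ} {M : ℝ≥0}
    (hc : StrongConvexOn Set.univ m f) (hf : Differentiable ℝ f) (hL : LipschitzWith M (∇ f)) :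
    m ≤ M := by
  obtain ⟨x, hx⟩ := exists_ne (0 : E)
  have h1 := hc.inner_gradient_sub_ge hf x 0
  have h2 := real_inner_le_norm (∇ f x - ∇ f 0) (x - 0)
  have h3 := hL.norm_sub_le x 0
  rw [sub_zero] at h1 h2 h3
  have hx' : 0 < ‖x‖ := norm_pos_iff.2 hx
  have h4 : ‖∇ f x - ∇ f 0‖ * ‖x‖ ≤ M * ‖x‖ * ‖x‖ := by gcongr
  refine le_of_mul_le_mul_right ?_ (pow_pos hx' 2)
  linarith

/-- The bound on `h` gives `M h² ≤ (m / M)^(1/2) / 4`, and `m ≤ M`. -/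
theorem mul_sq_le_quarter_of_le_div_rpow {m M h : ℝ} (hm : 0 < m) (hmM : m ≤ M) (hh : 0 < h)
    (hle : h ≤ m ^ (1 / 4 : ℝ) / (2 * M ^ (3 / 4 : ℝ))) : M * h ^ 2 ≤ 1 / 4 := by
  have hM : 0 < M := hm.trans_le hmM
  have h1 : m ^ (1 / 4 : ℝ) ≤ M ^ (1 / 4 : ℝ) := Real.rpow_le_rpow hm.le hmM (by norm_num)
  have h2 : M ^ (3 / 4 : ℝ) = M ^ (1 / 4 : ℝ) * M ^ (1 / 2 : ℝ) := by
    rw [← Real.rpow_add hM]; norm_num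
  have h4 : 0 < M ^ (1 / 4 : ℝ) := Real.rpow_pos_of_pos hM _
  have h5 : 0 < M ^ (1 / 2 : ℝ) := Real.rpow_pos_of_pos hM _
  rw [le_div_iff₀ (by positivity), h2] at hle
  have h6 : M ^ (1 / 4 : ℝ) * (2 * (h * M ^ (1 / 2 : ℝ))) ≤ M ^ (1 / 4 : ℝ) * 1 := by linarith
  have h7 := le_of_mul_le_mul_left h6 h4
  have h8 : (M ^ (1 / 2 : ℝ)) ^ 2 = M := by
    rw [← Real.rpow_natCast, ← Real.rpow_mul hM.le]; norm_num
  have h9 : (h * M ^ (1 / 2 : ℝ)) ^ 2 ≤ (1 / 2) ^ 2 :=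
    pow_le_pow_left₀ (by positivity) (by linarith) 2
  rw [mul_pow, h8] at h9
  linarith

theorem one_sub_pow_ceil_mul_le {θ A ε : ℝ} (hθ : 0 < θ) (hθ1 : θ ≤ 1) (hA : 0 ≤ A)
    (hε : 0 < ε) :
    (1 - θ) ^ ⌈1 / θ * Real.log (4 / ε ^ 2 * A)⌉₊ * (4 * A) ≤ ε ^ 2 := by
  rcases hA.eq_or_lt with rfl | hA
  · simp; positivity
  set n := ⌈1 / θ * Real.log (4 / ε ^ 2 * A)⌉₊
  have h1 : Real.log (4 / ε ^ 2 * A) ≤ n * θ := by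
    have := Nat.le_ceil (1 / θ * Real.log (4 / ε ^ 2 * A))
    calc _ = θ * (1 / θ * Real.log (4 / ε ^ 2 * A)) := by field_simp
      _ ≤ θ * n := by gcongr
      _ = n * θ := mul_comm _ _
  have h2 : (1 - θ) ^ n ≤ Real.exp (-(n * θ)) := by
    rw [← mul_neg, Real.exp_nat_mul]
    exact pow_le_pow_left₀ (by linarith) (Real.one_sub_le_exp_neg θ) n
  have h3 : Real.exp (-(n * θ)) ≤ (4 / ε ^ 2 * A)⁻¹ := by
    rw [← Real.exp_log (show 0 < 4 / ε ^ 2 * A by positivity), ← Real.exp_neg]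
    exact Real.exp_le_exp.2 (by linarith)
  calc (1 - θ) ^ n * (4 * A) ≤ (4 / ε ^ 2 * A)⁻¹ * (4 * A) := by
        have := h2.trans h3; gcongr
    _ = ε ^ 2 := by field_simp

variable {d : ℕ} {f : EuclideanSpace ℝ (Fin d) → ℝ} {m₂ : ℝ} {M₂ : ℝ≥0}
  {x₀ : EuclideanSpace ℝ (Fin d)} {ε h : ℝ}

theorem IsNoisyHMC.wassersteinDist_le {Ω : Type*} [MeasurableSpace Ω] {P : Measure Ω}
    [IsProbabilityMeasure P]
    {v : Fin (hmcIterations f m₂ x₀ ε h) → Ω → EuclideanSpace ℝ (Fin d)}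
    {x : Fin (hmcIterations f m₂ x₀ ε h + 1) → Ω → EuclideanSpace ℝ (Fin d)}
    (hrun : IsNoisyHMC P f m₂ x₀ ε h v x) (hm : 0 < m₂) (hmM : m₂ ≤ M₂)
    (hc : StrongConvexOn Set.univ m₂ f) (hf : Differentiable ℝ f)
    (hL : LipschitzWith M₂ (∇ f)) (hε : 0 < ε) (hh : 0 < h) (hMh : M₂ * h ^ 2 ≤ 1 / 4) :
    wassersteinDist 2 (P.map (x (Fin.last _))) (gibbsMeasure f) ≤ ENNReal.ofReal (ε / √m₂) := by
  have hM : 0 < M₂ := by exact_mod_cast hm.trans_le hmM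
  have hmh : m₂ * h ^ 2 ≤ 1 / 4 := (mul_le_mul_of_nonneg_right hmM (by positivity)).trans hMh
  set θ := hmcTheta m₂ h with hθ
  have hθ0 : 0 < θ := by simp only [hθ, hmcTheta]; positivity
  have hθ1 : θ ≤ 1 := by simp only [hθ, hmcTheta]; linarith
  have hint := hc.integrable_exp_neg hm hf
  have hprob : IsProbabilityMeasure (gibbsMeasure f) := isProbabilityMeasure_tilted hint
  obtain ⟨Φ, hΦ⟩ := exists_isHamiltonianFlow hL hM hh.le hMh
  have hpres : MeasurePreserving Φ ((gibbsMeasure f).prod (stdGaussian _))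
      ((gibbsMeasure f).prod (stdGaussian _)) := hΦ.measurePreserving hf hL hh.le hint
  have hconv : ∀ x y, f x + inner ℝ (∇ f x) (y - x) ≤ f y := fun x y => by
    have := hc.add_inner_gradient_le hf x y
    have : 0 ≤ m₂ / 2 * ‖y - x‖ ^ 2 := by positivity
    linarith
  have hsm : 0 < √m₂ := Real.sqrt_pos.2 hm
  have hsq : √m₂ ^ 2 = m₂ := Real.sq_sqrt hm.le
  obtain ⟨hi2, hmom⟩ := hc.integral_norm_sub_sq_tilted_le hm hf hL x₀
  -- The permitted error `θ ε / (2 √m₂)` is `(1 - c) b` for these values of `c` and `b`.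
  refine wassersteinDist_perturbed_iteration_le (φ := fun y w => (Φ (y, w)).1)
    (γ := stdGaussian _) (c := 1 - θ) (b := ε / (2 * √m₂)) (x₀ := x₀) (v := v)
    (measurePreserving_fst.comp hpres) (by linarith) (by linarith) (fun y y' w => ?_)
    hrun.law_velocity hrun.indep_velocity (hrun.aemeasurable _) hrun.start (fun k => ?_) hi2
    (by positivity) ?_
  · obtain ⟨q, p, hs, h0, hT⟩ := hΦ (y, w)
    obtain ⟨q', p', hs', h0', hT'⟩ := hΦ (y', w)
    have := norm_sub_le_of_hamiltonian hm.le M₂.2 hmM hh hMh (hc.inner_gradient_sub_ge hf)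
      (norm_gradient_sub_sq_le hconv hM hf hL) hL.continuous hL.norm_sub_le hs.position
      hs.velocity hs'.position hs'.velocity
      ((congrArg Prod.snd h0).trans (congrArg Prod.snd h0').symm)
    have e : q 0 = y := congrArg Prod.fst h0
    have e' : q' 0 = y' := congrArg Prod.fst h0'
    rw [e, e'] at this
    rw [← hT, ← hT']
    exact this
  · filter_upwards [hrun.step k] with ω ⟨q, ⟨p, hq0, hp0, hq, hp⟩, hle⟩
    have := hΦ.apply_eq hL hh.le ⟨hq, hp⟩
    rw [hq0, hp0] at this
    rw [this]
    refine hle.trans (le_of_eq ?_)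
    rw [sub_sub_cancel, mul_div_assoc]
  · set n := hmcIterations f m₂ x₀ ε h with hn
    set A := ‖∇ f x₀‖ ^ 2 / m₂ + d with hA
    have hA0 : 0 ≤ A := by positivity
    have hr : (1 - θ) ^ n * (4 * A) ≤ ε ^ 2 := one_sub_pow_ceil_mul_le hθ0 hθ1 hA0 hε
    have hr0 : 0 ≤ (1 - θ) ^ n := pow_nonneg (by linarith) n
    rw [finrank_euclideanSpace_fin, ← hA] at hmom
    have h1 : (1 - θ) ^ n * ∫ y, ‖y - x₀‖ ^ 2 ∂(gibbsMeasure f) ≤ (1 - θ) ^ n * (2 * A / m₂) :=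
      mul_le_mul_of_nonneg_left hmom hr0
    have h2 : (1 - θ) ^ n * (2 * A / m₂) ≤ ε ^ 2 / 2 / m₂ := by
      rw [← mul_div_assoc]
      gcongr
      linarith
    have h3 : (1 - (1 - θ) ^ n) * (ε / (2 * √m₂)) ^ 2 ≤ 1 * (ε / (2 * √m₂)) ^ 2 := by
      gcongr
      linarith
    have h4 : (ε / (2 * √m₂)) ^ 2 = ε ^ 2 / 4 / m₂ := by
      rw [div_pow, mul_pow, hsq]; field_simp; norm_num
    have h5 : (ε / √m₂) ^ 2 = ε ^ 2 / m₂ := by rw [div_pow, hsq]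
    have h6 : ε ^ 2 / 2 / m₂ + ε ^ 2 / 4 / m₂ ≤ ε ^ 2 / m₂ := by
      rw [← add_div]
      gcongr
      linarith [sq_nonneg ε]
    rw [h5]
    linarith

theorem hmcIterations_eq_zero_of_subsingleton (f : EuclideanSpace ℝ (Fin 0) → ℝ)
    (x₀ : EuclideanSpace ℝ (Fin 0)) : hmcIterations f m₂ x₀ ε h = 0 := by
  have : ∇ f x₀ = 0 := Subsingleton.elim _ _
  -- The logarithm is taken at `0`, where `Real.log` has the value `0`.
  simp [hmcIterations, this]

/-- The constant is `34 = 8 · 4 + 2`: `8` from `1 / θ`, `4` from `log (4 A / ε²) ≤ 4 log s`, and `2`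
to absorb the rounding up, since `κ log s ≥ 4 · 0.69`. -/
theorem hmcIterations_le (hd : 1 ≤ d) (hm : 0 < m₂) (hε : 0 < ε) (hh : 0 < h)
    (hmh : m₂ * h ^ 2 ≤ 1 / 4) :
    (hmcIterations f m₂ x₀ ε h : ℝ) ≤
      34 * (1 / (m₂ * h ^ 2)) * Real.log (max 2 ((‖∇ f x₀‖ ^ 2 / m₂ + d) / ε)) := by
  set A := ‖∇ f x₀‖ ^ 2 / m₂ + d with hA
  have hA1 : 1 ≤ A := by
    have : (1 : ℝ) ≤ d := by exact_mod_cast hd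
    have : 0 ≤ ‖∇ f x₀‖ ^ 2 / m₂ := by positivity
    linarith
  set s := max 2 (A / ε) with hs
  have hs2 : 2 ≤ s := le_max_left _ _
  have hs0 : 0 < s := by linarith
  have hl2 : 0.69 ≤ Real.log s :=
    (by linarith [Real.log_two_gt_d9] : (0.69 : ℝ) ≤ Real.log 2).trans
      (Real.log_le_log (by norm_num) hs2)
  have hlog : Real.log (4 / ε ^ 2 * A) ≤ 4 * Real.log s := by
    -- Here `A ≤ A²` because `d ≥ 1`, and the factor `4` is at most `s²`.
    have h1 : 4 / ε ^ 2 * A ≤ s ^ 4 := by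
      have h2 : A ≤ A ^ 2 := by nlinarith
      calc 4 / ε ^ 2 * A ≤ 4 / ε ^ 2 * A ^ 2 := by gcongr
        _ = 2 ^ 2 * (A / ε) ^ 2 := by field_simp; norm_num
        _ ≤ s ^ 2 * s ^ 2 := by
          gcongr
          exact le_max_right _ _
        _ = s ^ 4 := by ring
    refine (Real.log_le_log (by positivity) h1).trans (le_of_eq ?_)
    rw [Real.log_pow]; norm_num
  set κ := 1 / (m₂ * h ^ 2) with hκ
  have hκ4 : 4 ≤ κ := by
    rw [hκ, le_div_iff₀ (by positivity)]; linarith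
  have hθ : 1 / hmcTheta m₂ h = 8 * κ := by
    rw [hκ, hmcTheta]; field_simp
  have hX : 1 / hmcTheta m₂ h * Real.log (4 / ε ^ 2 * A) ≤ 32 * κ * Real.log s := by
    rw [hθ]
    have := mul_le_mul_of_nonneg_left hlog (show 0 ≤ 8 * κ by linarith)
    linarith
  have hκs : 4 * 0.69 ≤ κ * Real.log s := by gcongr
  have hceil : (hmcIterations f m₂ x₀ ε h : ℝ) ≤ 32 * κ * Real.log s + 1 := by
    refine le_trans ?_ (Nat.ceil_lt_add_one (by nlinarith)).le
    exact_mod_cast Nat.ceil_mono hX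
  linarith

end NoisyHMC

theorem mainTheorem5 :
    ∃ C : ℝ, 0 < C ∧
      ∀ (d : ℕ) (f : EuclideanSpace ℝ (Fin d) → ℝ) (m₂ : ℝ) (M₂ : ℝ≥0)
        (x₀ : EuclideanSpace ℝ (Fin d)) (ε h : ℝ),
        0 < m₂ → StrongConvexOn Set.univ m₂ f →
        Differentiable ℝ f → LipschitzWith M₂ (∇ f) →
        0 < ε → 0 < h → h ≤ m₂ ^ (1 / 4 : ℝ) / (2 * (M₂ : ℝ) ^ (3 / 4 : ℝ)) →
        (∀ (Ω : Type*) [MeasurableSpace Ω] (P : Measure Ω) [IsProbabilityMeasure P]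
          (v : Fin (hmcIterations f m₂ x₀ ε h) → Ω → EuclideanSpace ℝ (Fin d))
          (x : Fin (hmcIterations f m₂ x₀ ε h + 1) → Ω → EuclideanSpace ℝ (Fin d)),
          IsNoisyHMC P f m₂ x₀ ε h v x →
          wassersteinDist 2 (P.map (x (Fin.last _))) (gibbsMeasure f) ≤
            ENNReal.ofReal (ε / √m₂)) ∧
        (hmcIterations f m₂ x₀ ε h : ℝ) ≤
          C * (1 / (m₂ * h ^ 2)) * Real.log (max 2 ((‖∇ f x₀‖ ^ 2 / m₂ + d) / ε)) := by
  refine ⟨34, by norm_num, fun d f m₂ M₂ x₀ ε h hm hc hf hL hε hh hle => ?_⟩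
  -- The inequality `m₂ ≤ M₂` requires a nonzero vector. For `d = 0` the space is a point, every
  -- coupling has cost zero and no iteration is made.
  rcases Nat.eq_zero_or_pos d with rfl | hd
  · refine ⟨fun Ω _ P _ v x hrun => ?_, ?_⟩
    · have : IsProbabilityMeasure (gibbsMeasure f) :=
        isProbabilityMeasure_tilted (hc.integrable_exp_neg hm hf)
      have : IsProbabilityMeasure (P.map (x (Fin.last _))) :=
        Measure.isProbabilityMeasure_map (hrun.aemeasurable _)
      refine wassersteinDist_two_le_of_isCoupling
        (γ := (P.map (x (Fin.last _))).prod (gibbsMeasure f))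
        ⟨measurePreserving_fst.map_eq, measurePreserving_snd.map_eq⟩ (by positivity) ?_
      have h0 : ∀ z : EuclideanSpace ℝ (Fin 0) × EuclideanSpace ℝ (Fin 0), z.1 - z.2 = 0 :=
        fun z => Subsingleton.elim _ _
      simp [h0]
    · rw [hmcIterations_eq_zero_of_subsingleton, Nat.cast_zero]
      exact mul_nonneg (by positivity) (Real.log_nonneg (le_max_of_le_left (by norm_num)))
  · have : Nonempty (Fin d) := ⟨⟨0, hd⟩⟩
    have hmM : m₂ ≤ M₂ := hc.le_of_lipschitzWith_gradient hf hL
    have hMh := mul_sq_le_quarter_of_le_div_rpow hm hmM hh hle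
    exact ⟨fun Ω _ P _ v x hrun => hrun.wassersteinDist_le hm hmM hc hf hL hε hh hMh,
      hmcIterations_le hd hm hε hh
        ((mul_le_mul_of_nonneg_right hmM (by positivity)).trans hMh)⟩
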